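/- Let $v_x,v_y>0$ be fixed and put $r=v_y/v_x\in(0,\infty)$ (ratio of future to past variance), $v=(1+r^{-1})^{-1}$. For $\theta\in\mathbb R^n$ one observes $X\sim N_n(\theta,v_xI)$ and wants to estimate the density of a future $Y\sim N_n(\theta,v_yI)$, independent of $X$ given $\theta$. A predictive density estimate $\hat p(y\mid x)\ge 0$ is jointly measurable with $\int\hat p(y\mid x)\,dy=1$ for all $x$; its predictive Kullback–Leibler risk is $$\rho(\theta,\hat p)=\mathbb E_{X\sim N_n(\theta,v_xI)}\,\mathrm{KL}\big(N_n(\theta,v_yI)\,\big\|\,\hat p(\cdot\mid X)\big)\in[0,\infty].$$ Let $\Theta_0[s]=\{\theta\in\mathbb R^n:\#\{i:\theta_i\ne0\}\le s\}$ and let $R^*(\Theta_0[s])=\inf_{\hat p}\sup_{\theta\in\Theta_0[s]}\rho(\theta,\hat p)$, the infimum being over all predictive density estimates. For $\eta\in(0,1)$ let $\lambda_e=\sqrt{2\log\eta^{-1}}$, $\lambda_f=\sqrt{2\log\eta^{-v}}$, and $$K=1+\Big\lceil\frac{\log(1+r^{-1})}{2\log(1+4r)}\Big\rceil\mathbf 1\{r<1/2\}.$$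 Let $\mu_{1k}=\min\{\lambda_f(1+4r)^{k-1},\lambda_e\}$ for $1\le k\le K$, $\mu_{jk}=(j-1)\mu_{1K}+\mu_{1k}$ for $j\ge2$, $\mu_{jk}=-\mu_{-j,k}$ for $j\le-1$, and $C_j=\frac1K\sum_{k=1}^K\delta_{\mu_{jk}}$. The univariate clustered discrete prior is $$\pi_C[\eta,r]=(1-\eta)\delta_0+\frac{1-\eta}{2}\sum_{j=1}^\infty\eta^j\,(C_j+C_{-j}).$$ Let $\hat p_C=\hat p_C[\eta,r]$ be the Bayes predictive density estimate on $\mathbb R^n$ (the average of the $N_n(\theta,v_yI)$ density of $y$ over the posterior of $\theta$ given $X=x$) for the prior under which the coordinates of $\theta/\sqrt{v_x}$ are i.i.d. with law $\pi_C[\eta,r]$. **Theorem.** Let $s_n\ge1$ be integers with $\eta_n=s_n/n\to0$ as $n\to\infty$. Then, with $\hat p_C=\hat p_C[\eta_n,r]$ on $\mathbb R^n$, $$\sup_{\theta\in\Theta_0[s_n]}\rho(\theta,\hat p_C)\le\frac{n\,\eta_n\log(\eta_n^{-1})}{1+r}\,(1+o(1)),$$ and $\hat p_C$, which is a predictive density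 estimate for all large $n$, is asymptotically minimax: $$\frac{\sup_{\theta\in\Theta_0[s_n]}\rho(\theta,\hat p_C)}{R^*(\Theta_0[s_n])}\longrightarrow1.$$ Moreover, in dimension $n=1$, as $\eta\to0^+$, $$\rho(0,\hat p_C[\eta,r])\le\eta\,(1+o(1)),\qquad \sup_{\theta\ne0}\rho(\theta,\hat p_C[\eta,r])\le\frac{\lambda_f^2}{2r}\,(1+o(1)).$$ -/

import Mathlib

open MeasureTheory ProbabilityTheory Filter Topology
open scoped ENNReal NNReal

noncomputable section

namespace SparsePrediction

/-- The law `N_n(θ, v I)` of a Gaussian vector with independent coordinates of variance `v`. -/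
def gaussianVec {n : ℕ} (θ : Fin n → ℝ) (v : ℝ≥0) : Measure (Fin n → ℝ) :=
  Measure.pi fun i => gaussianReal (θ i) v

/-- The Lebesgue density of `N_n(θ, v I)` at `z`. -/
def gaussianVecPDF {n : ℕ} (θ : Fin n → ℝ) (v : ℝ≥0) (z : Fin n → ℝ) : ℝ≥0∞ :=
  ∏ i, gaussianPDF (θ i) v (z i)

/-- A predictive density estimate `p̂(y | x)`, written `p x y`: jointly measurable, and a
probability density in `y` for every value of the observed past `x`. -/
def IsPredictiveDensity {n : ℕ} (p : (Fin n → ℝ) → (Fin n → ℝ) → ℝ≥0∞) : Prop :=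
  Measurable (Function.uncurry p) ∧ ∀ x, ∫⁻ y, p x y = 1

/-- Predictive Kullback-Leibler risk at `θ`: the expectation, over the past `X ∼ N_n(θ, vx I)`, of
the divergence of the estimated density `p̂(· | X)` from the law `N_n(θ, vy I)` of the future. -/
def predictiveRisk {n : ℕ} (vx vy : ℝ≥0) (p : (Fin n → ℝ) → (Fin n → ℝ) → ℝ≥0∞)
    (θ : Fin n → ℝ) : ℝ≥0∞ :=
  ∫⁻ x, InformationTheory.klDiv (gaussianVec θ vy) (volume.withDensity (p x)) ∂(gaussianVec θ vx)

/-- The sparse parameter set `Θ₀[s]`: vectors with at most `s` nonzero coordinates. -/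
def sparseSet (n s : ℕ) : Set (Fin n → ℝ) :=
  {θ | (Finset.univ.filter fun i => θ i ≠ 0).card ≤ s}

/-- Maximal risk of an estimate over the sparse set. -/
def maxRisk {n : ℕ} (vx vy : ℝ≥0) (s : ℕ) (p : (Fin n → ℝ) → (Fin n → ℝ) → ℝ≥0∞) : ℝ≥0∞ :=
  ⨆ θ ∈ sparseSet n s, predictiveRisk vx vy p θ

/-- Minimax risk over the sparse set, among all predictive density estimates. -/
def minimaxRisk (vx vy : ℝ≥0) (n s : ℕ) : ℝ≥0∞ :=
  ⨅ (p : (Fin n → ℝ) → (Fin n → ℝ) → ℝ≥0∞) (_ : IsPredictiveDensity p), maxRisk vx vy s p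

/-- The Bayes predictive density estimate of a prior: the conditional density of the future given
the past, that is, the average of the future density over the posterior distribution. -/
def bayesEstimate {n : ℕ} (vx vy : ℝ≥0) (prior : Measure (Fin n → ℝ)) (x y : Fin n → ℝ) : ℝ≥0∞ :=
  (∫⁻ θ, gaussianVecPDF θ vx x * gaussianVecPDF θ vy y ∂prior) /
    ∫⁻ θ, gaussianVecPDF θ vx x ∂prior

/-- `v = (1 + r⁻¹)⁻¹`. -/
def vFactor (r : ℝ) : ℝ := (1 + r⁻¹)⁻¹

/-- `λ_e = √(2 log η⁻¹)`. -/
def lambdaE (η : ℝ) : ℝ := √(2 * Real.log η⁻¹)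

/-- `λ_f = √(2 log η^(-v))`. -/
def lambdaF (η r : ℝ) : ℝ := √(2 * Real.log (η ^ (-vFactor r)))

open Classical in
/-- The number `K(r)` of atoms in a cluster. -/
def clusterSize (r : ℝ) : ℕ :=
  1 + if r < 1 / 2 then ⌈Real.log (1 + r⁻¹) / (2 * Real.log (1 + 4 * r))⌉₊ else 0

/-- The atoms `μ_{1k} = λ_f (1 + 4r)^(k-1) ∧ λ_e`, `1 ≤ k ≤ K`, of the first cluster. -/
def firstAtom (η r : ℝ) (k : ℕ) : ℝ := min (lambdaF η r * (1 + 4 * r) ^ (k - 1)) (lambdaE η)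

/-- The atom `μ_{jk}`: it is `(j-1) μ_{1K} + μ_{1k}` for `j ≥ 1`, and `-μ_{-j,k}` for `j ≤ -1`. -/
def atom (η r : ℝ) (j : ℤ) (k : ℕ) : ℝ :=
  (j.sign : ℝ) * (((|j| : ℤ) - 1 : ℝ) * firstAtom η r (clusterSize r) + firstAtom η r k)

/-- The cluster `C_j`, the uniform distribution on the atoms `μ_{j1}, …, μ_{jK}`. -/
def cluster (η r : ℝ) (j : ℤ) : Measure ℝ :=
  ((clusterSize r : ℝ≥0∞)⁻¹) •
    ∑ k ∈ Finset.Icc 1 (clusterSize r), Measure.dirac (atom η r j k)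

/-- The univariate clustered discrete prior `π_C[η, r]`, for past variance one; the summation
index `i` stands for `j = i + 1`. -/
def clusterPrior (η r : ℝ) : Measure ℝ :=
  ENNReal.ofReal (1 - η) • Measure.dirac 0 +
    ENNReal.ofReal ((1 - η) / 2) • Measure.sum fun i : ℕ =>
      ENNReal.ofReal (η ^ (i + 1)) • (cluster η r (i + 1) + cluster η r (-(i + 1)))

/-- The multivariate clustered prior on `ℝⁿ`: independent coordinates, each distributed as
`π_C[η, r]` with `r = vy / vx`, in units of the standard deviation `√vx` of the past. -/
def clusterPriorVec (n : ℕ) (η : ℝ) (vx vy : ℝ≥0) : Measure (Fin n → ℝ) :=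
  Measure.pi fun _ => (clusterPrior η ((vy : ℝ) / vx)).map fun t => √(vx : ℝ) * t

/-- The Bayes predictive density estimate `p̂_C` of the clustered prior. -/
def clusterEstimate (n : ℕ) (η : ℝ) (vx vy : ℝ≥0) : (Fin n → ℝ) → (Fin n → ℝ) → ℝ≥0∞ :=
  bayesEstimate vx vy (clusterPriorVec n η vx vy)

end SparsePrediction

end

/-!
The clustered prior is a product prior, so the predictive risk of its Bayes estimate is a sum of
univariate risks, and everything reduces to the univariate risk at the origin, the univariate risk
off the origin, and a lower bound for the minimax risk. Throughout `L = log η⁻¹`.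

*Upper bounds.* If the ratio of the true future density to the estimate is at most `exp (g x + h y)`
then the risk is at most the mean of `g + h` (`klDiv_le_of_le_withDensity`,
`predictiveRisk_le_sum`). The estimate is the joint density of past and future divided by the
marginal density of the past. At the origin the joint density is bounded below by the contribution
of the atom at zero, and since the likelihood ratio of the past has mean one, the risk is at most
`-log (1 - η)` (`hasRiskBound_zero`). At a general mean `t` the joint density is bounded below by
the contribution of one well chosen atom `μ`, and the marginal density is bounded by a
Laplace-type estimate. In units of the past standard deviation this leaves, up to `o(L)`, the
difference of `(t - μ)² (1 + 1 / r) / 2 + j L`, with `j` the index of the cluster of `μ`, and the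
minimum over all atoms `x` of `(t - x)² / 2 + i L`. That this is at most `L / (1 + r)` for a
suitable `μ` is a deterministic statement about the atoms (`exists_isAtom`). For `r < 1 / 2` it
holds because the ratio `1 + 4 r` of consecutive atoms makes the parabolas centred at them cross at
the right level (`sq_sub_le_of_ratio`), and because the period of the clusters is then `λ_e`; for
`r ≥ 1 / 2` the clusters are single points with period `λ_f`.

*Lower bound.* Divide the coordinates into `s` blocks of length `m = ⌊n / s⌋` and put one spike of
height `τ` uniformly at random into each block, where `(1 / vx + 1 / vy) τ² / 2 = log m`: this is
the threshold below which past and future together do not reveal the position of the spike. A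
variational bound for the divergence (`ofReal_one_add_integral_le_klDiv_add`), with the logarithm of
the future likelihood ratio minus the logarithm of the block averages of the joint likelihood ratios
as test function, shows that no estimate does better than
`s τ² / (2 vy) = s log m / (1 + r)` up to terms of order `s √(log m)` (`ofReal_le_maxRisk`). Since
`log m` is `L` up to a bounded term, upper and lower bounds agree to first order.
-/

namespace SparsePrediction

/-! ### Product measures -/

lemma lintegral_pi_prod {ι : Type*} [Fintype ι] {α : ι → Type*} [∀ i, MeasurableSpace (α i)]
    (μ : ∀ i, Measure (α i)) [∀ i, IsProbabilityMeasure (μ i)] {f : ∀ i, α i → ℝ≥0∞}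
    (hf : ∀ i, Measurable (f i)) :
    ∫⁻ z, ∏ i, f i (z i) ∂Measure.pi μ = ∏ i, ∫⁻ t, f i t ∂μ i := by
  have h := lintegral_prod_eq_prod_lintegral_of_indepFun (μ := Measure.pi μ) Finset.univ
    (fun i z => f i (z i)) (iIndepFun_pi fun i => (hf i).aemeasurable)
    (fun i => (hf i).comp (measurable_pi_apply i))
  rw [h]
  refine Finset.prod_congr rfl fun i _ => ?_
  exact (measurePreserving_eval μ i).lintegral_comp (hf i)

lemma measurable_gaussianVecPDF {n : ℕ} (θ : Fin n → ℝ) (v : ℝ≥0) :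
    Measurable (gaussianVecPDF θ v) :=
  Finset.measurable_prod _ fun i _ => (measurable_gaussianPDF (θ i) v).comp (measurable_pi_apply i)

lemma gaussianVecPDF_eq_ofReal {n : ℕ} (θ : Fin n → ℝ) (v : ℝ≥0) (z : Fin n → ℝ) :
    gaussianVecPDF θ v z = ENNReal.ofReal (∏ i, gaussianPDFReal (θ i) v (z i)) :=
  (ENNReal.ofReal_prod_of_nonneg fun _ _ => gaussianPDFReal_nonneg _ _ _).symm

lemma gaussianVec_eq_withDensity {n : ℕ} (θ : Fin n → ℝ) {v : ℝ≥0} (hv : v ≠ 0) :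
    gaussianVec θ v = (volume : Measure (Fin n → ℝ)).withDensity (gaussianVecPDF θ v) := by
  refine Measure.pi_eq fun s hs => ?_
  rw [withDensity_apply _ (MeasurableSet.univ_pi hs)]
  simp_rw [gaussianVecPDF_eq_ofReal]
  rw [volume_pi, Measure.restrict_pi_pi, ← ofReal_integral_eq_lintegral_ofReal,
    integral_fintype_prod_eq_prod (fun i => gaussianPDFReal (θ i) v),
    ENNReal.ofReal_prod_of_nonneg fun i _ => integral_nonneg fun _ => gaussianPDFReal_nonneg _ _ _]
  · exact Finset.prod_congr rfl fun i _ => (gaussianReal_apply_eq_integral _ hv _).symm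
  · exact Integrable.fintype_prod (f := fun i => gaussianPDFReal (θ i) v)
      fun i => (integrable_gaussianPDFReal _ _).restrict
  · exact ae_of_all _ fun z => Finset.prod_nonneg fun i _ => gaussianPDFReal_nonneg _ _ _

instance {n : ℕ} (θ : Fin n → ℝ) (v : ℝ≥0) : IsProbabilityMeasure (gaussianVec θ v) := by
  unfold gaussianVec; infer_instance

lemma lintegral_gaussianVecPDF {n : ℕ} (θ : Fin n → ℝ) {v : ℝ≥0} (hv : v ≠ 0) :
    ∫⁻ z, gaussianVecPDF θ v z = 1 := by
  have h : gaussianVec θ v Set.univ = 1 := measure_univ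
  rwa [gaussianVec_eq_withDensity θ hv, withDensity_apply _ MeasurableSet.univ,
    setLIntegral_univ] at h

/-! ### Two-sided control of the Kullback-Leibler divergence -/

section KL

variable {α : Type*} [MeasurableSpace α] {μ ν : Measure α}

open InformationTheory

/-- A pointwise bound on the likelihood ratio, here in the form `μ ≤ exp U • ν`, bounds the
divergence by the mean of `U`; no integrability of the logarithm itself has to be checked. -/
lemma klDiv_le_of_le_withDensity [IsProbabilityMeasure μ] [IsProbabilityMeasure ν] {U : α → ℝ}
    (hUi : Integrable U μ)
    (h : μ ≤ ν.withDensity fun y => ENNReal.ofReal (Real.exp (U y))) :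
    klDiv μ ν ≤ ENNReal.ofReal (∫ y, U y ∂μ) ∧ 0 ≤ ∫ y, U y ∂μ := by
  have hac : μ ≪ ν := (Measure.absolutelyContinuous_of_le h).trans
    (withDensity_absolutelyContinuous _ _)
  have hle : μ.rnDeriv ν ≤ᵐ[ν] fun y => ENNReal.ofReal (Real.exp (U y)) := by
    refine ae_le_of_forall_setLIntegral_le_of_sigmaFinite (Measure.measurable_rnDeriv _ _) ?_
    intro s hs _
    calc ∫⁻ x in s, μ.rnDeriv ν x ∂ν ≤ μ s := Measure.setLIntegral_rnDeriv_le s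
      _ ≤ _ := h s
      _ = _ := withDensity_apply _ hs
  have hpt : ∀ᵐ y ∂ν, klFun (μ.rnDeriv ν y).toReal ≤
      (μ.rnDeriv ν y).toReal * U y + (1 - (μ.rnDeriv ν y).toReal) := by
    filter_upwards [hle, Measure.rnDeriv_lt_top μ ν] with y hy hy'
    have h1 : (μ.rnDeriv ν y).toReal ≤ Real.exp (U y) := by
      have := ENNReal.toReal_mono ENNReal.ofReal_ne_top hy
      rwa [ENNReal.toReal_ofReal (Real.exp_pos _).le] at this
    rw [klFun_apply]
    rcases (ENNReal.toReal_nonneg (a := μ.rnDeriv ν y)).eq_or_lt with h0 | h0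
    · simp [← h0]
    · have : Real.log (μ.rnDeriv ν y).toReal ≤ U y := by
        rw [Real.log_le_iff_le_exp h0]; exact h1
      nlinarith
  have i1 : Integrable (fun y => (μ.rnDeriv ν y).toReal * U y) ν :=
    (integrable_toReal_rnDeriv_mul_iff hac).2 hUi
  have i2 : Integrable (fun y => (μ.rnDeriv ν y).toReal) ν := Measure.integrable_toReal_rnDeriv
  have i3 : Integrable (fun y => (μ.rnDeriv ν y).toReal * U y + (1 - (μ.rnDeriv ν y).toReal)) ν :=
    i1.add ((integrable_const 1).sub i2)
  have hval : ∫ y, ((μ.rnDeriv ν y).toReal * U y + (1 - (μ.rnDeriv ν y).toReal)) ∂ν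
      = ∫ y, U y ∂μ := by
    have i4 : Integrable (fun y => 1 - (μ.rnDeriv ν y).toReal) ν := (integrable_const 1).sub i2
    rw [integral_add i1 i4, integral_sub (integrable_const 1) i2,
      integral_toReal_rnDeriv_mul hac, Measure.integral_toReal_rnDeriv hac]
    simp
  have hnn : 0 ≤ᵐ[ν] fun y => (μ.rnDeriv ν y).toReal * U y + (1 - (μ.rnDeriv ν y).toReal) := by
    filter_upwards [hpt] with y hy
    exact (klFun_nonneg ENNReal.toReal_nonneg).trans hy
  refine ⟨?_, hval ▸ integral_nonneg_of_ae hnn⟩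
  rw [klDiv_eq_lintegral_klFun_of_ac hac, ← hval, ofReal_integral_eq_lintegral_ofReal i3 hnn]
  refine lintegral_mono_ae ?_
  filter_upwards [hpt] with y hy
  exact ENNReal.ofReal_le_ofReal hy

/-- Young's inequality for the conjugate pair `ρ log ρ - ρ + 1`, `exp g - 1`. -/
lemma mul_add_one_le_klFun_add_exp {ρ : ℝ} (hρ : 0 ≤ ρ) (g : ℝ) :
    ρ * g + 1 ≤ klFun ρ + Real.exp g := by
  rw [klFun_apply]
  rcases hρ.eq_or_lt with h0 | h0
  · simp [← h0, (Real.exp_pos g).le]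
  · have h := Real.add_one_le_exp (g - Real.log ρ)
    rw [Real.exp_sub, Real.exp_log h0, le_div_iff₀ h0] at h
    nlinarith

/-- The variational lower bound for the divergence, in a form without subtraction. -/
lemma one_add_lintegral_le_klDiv_add [IsFiniteMeasure μ] [IsProbabilityMeasure ν] {g : α → ℝ}
    (hg : Measurable g) :
    1 + ∫⁻ y, ENNReal.ofReal (g y) ∂μ ≤
      klDiv μ ν + ∫⁻ y, ENNReal.ofReal (Real.exp (g y)) ∂ν + ∫⁻ y, ENNReal.ofReal (-g y) ∂μ := by
  by_cases hac : μ ≪ ν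
  swap
  · simp [klDiv_of_not_ac hac]
  have e1 := lintegral_rnDeriv_mul hac (f := fun y => ENNReal.ofReal (g y))
    (by fun_prop : Measurable fun y => ENNReal.ofReal (g y)).aemeasurable
  have e2 := lintegral_rnDeriv_mul hac (f := fun y => ENNReal.ofReal (-g y))
    (by fun_prop : Measurable fun y => ENNReal.ofReal (-g y)).aemeasurable
  rw [klDiv_eq_lintegral_klFun_of_ac hac, ← e1, ← e2]
  have hone : (1 : ℝ≥0∞) = ∫⁻ _, 1 ∂ν := by simp
  have hk : Measurable fun x => ENNReal.ofReal (klFun (μ.rnDeriv ν x).toReal) := by fun_prop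
  rw [hone, ← lintegral_add_left (by fun_prop), ← lintegral_add_left hk,
    ← lintegral_add_left (by fun_prop)]
  refine lintegral_mono_ae ?_
  filter_upwards [Measure.rnDeriv_lt_top μ ν] with y hy
  obtain ⟨ρ, hρ⟩ : ∃ ρ : ℝ≥0, μ.rnDeriv ν y = ρ := ⟨_, (ENNReal.coe_toNNReal hy.ne).symm⟩
  have key := mul_add_one_le_klFun_add_exp ρ.coe_nonneg (g y)
  simp only [hρ, ENNReal.coe_toReal]
  rw [← ENNReal.ofReal_coe_nnreal, ← ENNReal.ofReal_mul ρ.coe_nonneg, ← ENNReal.ofReal_mul ρ.coe_nonneg,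
    ← ENNReal.ofReal_add (klFun_nonneg ρ.coe_nonneg) (Real.exp_pos _).le]
  rcases le_total 0 (g y) with h | h
  · have h2 : ENNReal.ofReal ((ρ : ℝ) * -g y) = 0 :=
      ENNReal.ofReal_of_nonpos (by have := mul_nonneg ρ.coe_nonneg h; linarith)
    rw [h2, add_zero, ← ENNReal.ofReal_one, ← ENNReal.ofReal_add zero_le_one (mul_nonneg ρ.coe_nonneg h)]
    exact ENNReal.ofReal_le_ofReal (by linarith)
  · have h2 : ENNReal.ofReal ((ρ : ℝ) * g y) = 0 :=
      ENNReal.ofReal_of_nonpos (mul_nonpos_of_nonneg_of_nonpos ρ.coe_nonneg h)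
    rw [h2, add_zero, ← ENNReal.ofReal_one, ← ENNReal.ofReal_add
      (add_nonneg (klFun_nonneg ρ.coe_nonneg) (Real.exp_pos _).le)
      (mul_nonneg ρ.coe_nonneg (by linarith))]
    exact ENNReal.ofReal_le_ofReal (by linarith)

end KL

/-! ### Bayes predictive density estimates -/

lemma measurable_gaussianPDF_comp {α : Type*} [MeasurableSpace α] {f g : α → ℝ} (v : ℝ≥0)
    (hf : Measurable f) (hg : Measurable g) : Measurable fun a => gaussianPDF (f a) v (g a) :=
  Measurable.comp (g := fun a : ℝ × ℝ≥0 × ℝ => gaussianPDF a.1 a.2.1 a.2.2)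
    measurable_uncurry_gaussianPDF (hf.prodMk (measurable_const.prodMk hg))

lemma measurable_gaussianVecPDF_comp {α : Type*} [MeasurableSpace α] {n : ℕ}
    {f g : α → Fin n → ℝ} (v : ℝ≥0) (hf : Measurable f) (hg : Measurable g) :
    Measurable fun a => gaussianVecPDF (f a) v (g a) :=
  Finset.measurable_prod _ fun i _ => measurable_gaussianPDF_comp v
    ((measurable_pi_apply i).comp hf) ((measurable_pi_apply i).comp hg)

lemma gaussianPDF_le (μ : ℝ) (v : ℝ≥0) (x : ℝ) :
    gaussianPDF μ v x ≤ ENNReal.ofReal (√(2 * Real.pi * v))⁻¹ := by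
  rw [gaussianPDF, gaussianPDFReal]
  refine ENNReal.ofReal_le_ofReal (mul_le_of_le_one_right (by positivity) ?_)
  rw [Real.exp_le_one_iff]
  exact div_nonpos_of_nonpos_of_nonneg (by nlinarith [sq_nonneg (x - μ)]) (by positivity)

lemma gaussianVecPDF_le {n : ℕ} (θ : Fin n → ℝ) (v : ℝ≥0) (z : Fin n → ℝ) :
    gaussianVecPDF θ v z ≤ ENNReal.ofReal (√(2 * Real.pi * v))⁻¹ ^ n := by
  calc gaussianVecPDF θ v z ≤ ∏ _i : Fin n, ENNReal.ofReal (√(2 * Real.pi * v))⁻¹ :=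
        Finset.prod_le_prod' fun i _ => gaussianPDF_le _ _ _
    _ = _ := by simp

lemma gaussianVecPDF_pos {n : ℕ} (θ : Fin n → ℝ) {v : ℝ≥0} (hv : v ≠ 0) (z : Fin n → ℝ) :
    0 < gaussianVecPDF θ v z :=
  pos_iff_ne_zero.2 (Finset.prod_ne_zero_iff.2 fun i _ => (gaussianPDF_pos (θ i) hv (z i)).ne')

lemma lintegral_pos_of_pos {α : Type*} [MeasurableSpace α] (μ : Measure α)
    [IsProbabilityMeasure μ] {f : α → ℝ≥0∞} (hf : Measurable f) (h : ∀ a, 0 < f a) :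
    ∫⁻ a, f a ∂μ ≠ 0 := by
  intro h0
  rw [lintegral_eq_zero_iff hf] at h0
  obtain ⟨a, ha⟩ := h0.exists
  exact (h a).ne' ha

lemma lintegral_gaussianVecPDF_prior_ne_zero {n : ℕ} {vx : ℝ≥0} (hvx : vx ≠ 0)
    (prior : Measure (Fin n → ℝ)) [IsProbabilityMeasure prior] (x : Fin n → ℝ) :
    ∫⁻ θ, gaussianVecPDF θ vx x ∂prior ≠ 0 :=
  lintegral_pos_of_pos prior (measurable_gaussianVecPDF_comp vx measurable_id measurable_const)
    fun θ => gaussianVecPDF_pos θ hvx x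

lemma lintegral_gaussianVecPDF_prior_ne_top {n : ℕ} (vx : ℝ≥0)
    (prior : Measure (Fin n → ℝ)) [IsProbabilityMeasure prior] (x : Fin n → ℝ) :
    ∫⁻ θ, gaussianVecPDF θ vx x ∂prior ≠ ∞ := by
  refine ((lintegral_mono fun θ => gaussianVecPDF_le θ vx x).trans_lt ?_).ne
  rw [lintegral_const, measure_univ, mul_one]
  exact ENNReal.pow_lt_top ENNReal.ofReal_lt_top

theorem isPredictiveDensity_bayesEstimate {n : ℕ} {vx vy : ℝ≥0} (hvx : vx ≠ 0) (hvy : vy ≠ 0)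
    (prior : Measure (Fin n → ℝ)) [IsProbabilityMeasure prior] :
    IsPredictiveDensity (bayesEstimate vx vy prior) := by
  refine ⟨?_, fun x => ?_⟩
  · refine Measurable.div ?_ ?_
    · refine Measurable.lintegral_prod_right'
        (f := fun a : ((Fin n → ℝ) × (Fin n → ℝ)) × (Fin n → ℝ) =>
          gaussianVecPDF a.2 vx a.1.1 * gaussianVecPDF a.2 vy a.1.2) ?_
      exact (measurable_gaussianVecPDF_comp vx measurable_snd
        (measurable_fst.comp measurable_fst)).mul
        (measurable_gaussianVecPDF_comp vy measurable_snd (measurable_snd.comp measurable_fst))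
    · refine Measurable.lintegral_prod_right'
        (f := fun a : ((Fin n → ℝ) × (Fin n → ℝ)) × (Fin n → ℝ) =>
          gaussianVecPDF a.2 vx a.1.1) ?_
      exact measurable_gaussianVecPDF_comp vx measurable_snd (measurable_fst.comp measurable_fst)
  · have hxy : Measurable (Function.uncurry fun y θ : Fin n → ℝ =>
        gaussianVecPDF θ vx x * gaussianVecPDF θ vy y) :=
      (measurable_gaussianVecPDF_comp vx measurable_snd measurable_const).mul
        (measurable_gaussianVecPDF_comp vy measurable_snd measurable_fst)
    have hy (θ : Fin n → ℝ) : ∫⁻ y, gaussianVecPDF θ vx x * gaussianVecPDF θ vy y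
        = gaussianVecPDF θ vx x := by
      rw [lintegral_const_mul _ (measurable_gaussianVecPDF θ vy), lintegral_gaussianVecPDF θ hvy,
        mul_one]
    simp_rw [bayesEstimate, div_eq_mul_inv]
    have hm : Measurable fun y : Fin n → ℝ =>
        ∫⁻ θ, gaussianVecPDF θ vx x * gaussianVecPDF θ vy y ∂prior :=
      Measurable.lintegral_prod_right' hxy
    rw [lintegral_mul_const _ hm, lintegral_lintegral_swap hxy.aemeasurable]
    simp_rw [hy]
    exact ENNReal.mul_inv_cancel (lintegral_gaussianVecPDF_prior_ne_zero hvx prior x)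
      (lintegral_gaussianVecPDF_prior_ne_top vx prior x)

/-- The univariate marginal density of the past under the prior `π`. -/
noncomputable def marginal (π : Measure ℝ) (vx : ℝ≥0) (x : ℝ) : ℝ≥0∞ :=
  ∫⁻ μ, gaussianPDF μ vx x ∂π

/-- The univariate joint density of past and future under the prior `π`. -/
noncomputable def jointDensity (π : Measure ℝ) (vx vy : ℝ≥0) (x y : ℝ) : ℝ≥0∞ :=
  ∫⁻ μ, gaussianPDF μ vx x * gaussianPDF μ vy y ∂π

lemma measurable_gaussianPDF_mean (v : ℝ≥0) (x : ℝ) : Measurable fun μ => gaussianPDF μ v x :=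
  measurable_gaussianPDF_comp v measurable_id measurable_const

lemma measurable_marginal (π : Measure ℝ) [SFinite π] (vx : ℝ≥0) : Measurable (marginal π vx) := by
  refine Measurable.lintegral_prod_right' (f := fun a : ℝ × ℝ => gaussianPDF a.2 vx a.1) ?_
  exact measurable_gaussianPDF_comp vx measurable_snd measurable_fst

lemma lintegral_marginal (π : Measure ℝ) [IsProbabilityMeasure π] {vx : ℝ≥0} (hvx : vx ≠ 0) :
    ∫⁻ x, marginal π vx x = 1 := by
  have hm : Measurable (Function.uncurry fun x μ : ℝ => gaussianPDF μ vx x) :=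
    measurable_gaussianPDF_comp vx measurable_snd measurable_fst
  simp_rw [marginal]
  rw [lintegral_lintegral_swap hm.aemeasurable]
  simp [lintegral_gaussianPDF_eq_one _ hvx]

lemma marginal_ne_zero (π : Measure ℝ) [IsProbabilityMeasure π] {vx : ℝ≥0} (hvx : vx ≠ 0) (x : ℝ) :
    marginal π vx x ≠ 0 :=
  lintegral_pos_of_pos π (measurable_gaussianPDF_mean vx x) fun μ => gaussianPDF_pos μ hvx x

lemma marginal_ne_top (π : Measure ℝ) [IsProbabilityMeasure π] (vx : ℝ≥0) (x : ℝ) :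
    marginal π vx x ≠ ∞ := by
  refine ((lintegral_mono fun θ => gaussianPDF_le θ vx x).trans_lt ?_).ne
  rw [lintegral_const, measure_univ, mul_one]
  exact ENNReal.ofReal_lt_top

lemma bayesEstimate_pi {n : ℕ} (π : Measure ℝ) [IsProbabilityMeasure π] {vx : ℝ≥0} (hvx : vx ≠ 0)
    (vy : ℝ≥0) (x y : Fin n → ℝ) :
    bayesEstimate vx vy (Measure.pi fun _ => π) x y =
      ∏ i, jointDensity π vx vy (x i) (y i) / marginal π vx (x i) := by
  have h1 : ∫⁻ θ, gaussianVecPDF θ vx x * gaussianVecPDF θ vy y ∂Measure.pi (fun _ : Fin n => π) =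
      ∏ i, jointDensity π vx vy (x i) (y i) := by
    simp_rw [gaussianVecPDF, ← Finset.prod_mul_distrib]
    exact lintegral_pi_prod (fun _ : Fin n => π)
      (f := fun i μ => gaussianPDF μ vx (x i) * gaussianPDF μ vy (y i)) fun i =>
      (measurable_gaussianPDF_mean vx (x i)).mul (measurable_gaussianPDF_mean vy (y i))
  have h2 : ∫⁻ θ, gaussianVecPDF θ vx x ∂Measure.pi (fun _ : Fin n => π) =
      ∏ i, marginal π vx (x i) :=
    lintegral_pi_prod (fun _ : Fin n => π) (f := fun i μ => gaussianPDF μ vx (x i)) fun i =>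
      measurable_gaussianPDF_mean vx (x i)
  rw [bayesEstimate, h1, h2]
  exact (ENNReal.prod_div_distrib_of_ne_zero fun i _ => marginal_ne_zero π hvx _).symm

lemma isProbabilityMeasure_withDensity_of_lintegral_eq_one {n : ℕ} {q : (Fin n → ℝ) → ℝ≥0∞}
    (hq : ∫⁻ y, q y = 1) : IsProbabilityMeasure ((volume : Measure (Fin n → ℝ)).withDensity q) :=
  ⟨by rw [withDensity_apply _ MeasurableSet.univ, setLIntegral_univ, hq]⟩

/-- For a product estimate, coordinatewise bounds on the likelihood ratio of the true to the
estimated future density, with exponent separated into a function of the past and a function of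
the future, add up to a bound on the predictive risk. -/
theorem predictiveRisk_le_sum {n : ℕ} {vx vy : ℝ≥0} (hvy : vy ≠ 0)
    {p : (Fin n → ℝ) → (Fin n → ℝ) → ℝ≥0∞} (hp : IsPredictiveDensity p) {q : ℝ → ℝ → ℝ≥0∞}
    (hpq : ∀ x y, p x y = ∏ i, q (x i) (y i)) (θ : Fin n → ℝ) {g h : Fin n → ℝ → ℝ}
    (hh : ∀ i, Measurable (h i))
    (hgi : ∀ i, Integrable (g i) (gaussianReal (θ i) vx))
    (hhi : ∀ i, Integrable (h i) (gaussianReal (θ i) vy))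
    (hle : ∀ i x y, gaussianPDF (θ i) vy y ≤ ENNReal.ofReal (Real.exp (g i x + h i y)) * q x y) :
    predictiveRisk vx vy p θ ≤ ENNReal.ofReal
      (∑ i, (∫ x, g i x ∂gaussianReal (θ i) vx + ∫ y, h i y ∂gaussianReal (θ i) vy)) := by
  have hhi' (i : Fin n) : Integrable (fun y : Fin n → ℝ => h i (y i)) (gaussianVec θ vy) :=
    integrable_comp_eval (hhi i)
  have hgi' (i : Fin n) : Integrable (fun y : Fin n → ℝ => g i (y i)) (gaussianVec θ vx) :=
    integrable_comp_eval (hgi i)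
  have hhe (i : Fin n) : ∫ y, h i (y i) ∂gaussianVec θ vy = ∫ t, h i t ∂gaussianReal (θ i) vy :=
    integral_comp_eval (hhi i).1
  have hge (i : Fin n) : ∫ y, g i (y i) ∂gaussianVec θ vx = ∫ t, g i t ∂gaussianReal (θ i) vx :=
    integral_comp_eval (hgi i).1
  have key (x : Fin n → ℝ) :
      InformationTheory.klDiv (gaussianVec θ vy) (volume.withDensity (p x)) ≤
        ENNReal.ofReal (∑ i, (g i (x i) + ∫ t, h i t ∂gaussianReal (θ i) vy)) ∧
      0 ≤ ∑ i, (g i (x i) + ∫ t, h i t ∂gaussianReal (θ i) vy) := by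
    have hpx : Measurable (p x) := hp.1.comp measurable_prodMk_left
    have := isProbabilityMeasure_withDensity_of_lintegral_eq_one (hp.2 x)
    have hU : Measurable fun y : Fin n → ℝ => ∑ i, (g i (x i) + h i (y i)) :=
      Finset.measurable_sum _ fun i _ => ((hh i).comp (measurable_pi_apply i)).const_add _
    have hterm (i : Fin n) : Integrable (fun y : Fin n → ℝ => g i (x i) + h i (y i))
      (gaussianVec θ vy) := (integrable_const _).add (hhi' i)
    have hUi : Integrable (fun y : Fin n → ℝ => ∑ i, (g i (x i) + h i (y i))) (gaussianVec θ vy) :=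
      integrable_finsetSum _ fun i _ => hterm i
    have hval : ∫ y, ∑ i, (g i (x i) + h i (y i)) ∂gaussianVec θ vy =
        ∑ i, (g i (x i) + ∫ t, h i t ∂gaussianReal (θ i) vy) := by
      rw [integral_finsetSum _ fun i _ => hterm i]
      refine Finset.sum_congr rfl fun i _ => ?_
      rw [integral_add (integrable_const _) (hhi' i), hhe]
      simp
    rw [← hval]
    refine klDiv_le_of_le_withDensity hUi ?_
    have hE : Measurable fun y : Fin n → ℝ =>
        ENNReal.ofReal (Real.exp (∑ i, (g i (x i) + h i (y i)))) :=
      (Real.measurable_exp.comp hU).ennreal_ofReal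
    rw [gaussianVec_eq_withDensity θ hvy, ← withDensity_mul _ hpx hE]
    refine withDensity_mono (ae_of_all _ fun y => ?_)
    rw [Pi.mul_apply, hpq, Real.exp_sum, ENNReal.ofReal_prod_of_nonneg fun i _ =>
      (Real.exp_pos _).le, ← Finset.prod_mul_distrib]
    refine Finset.prod_le_prod' fun i _ => ?_
    rw [mul_comm]
    exact hle i _ _
  have hVi (i : Fin n) : Integrable
      (fun x : Fin n → ℝ => g i (x i) + ∫ t, h i t ∂gaussianReal (θ i) vy) (gaussianVec θ vx) :=
    (hgi' i).add (integrable_const _)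
  calc predictiveRisk vx vy p θ
      ≤ ∫⁻ x, ENNReal.ofReal (∑ i, (g i (x i) + ∫ t, h i t ∂gaussianReal (θ i) vy))
          ∂gaussianVec θ vx := lintegral_mono fun x => (key x).1
    _ = ENNReal.ofReal (∫ x, ∑ i, (g i (x i) + ∫ t, h i t ∂gaussianReal (θ i) vy)
          ∂gaussianVec θ vx) :=
        (ofReal_integral_eq_lintegral_ofReal (integrable_finsetSum _ fun i _ => hVi i)
          (ae_of_all _ fun x => (key x).2)).symm
    _ = _ := by
        rw [integral_finsetSum _ fun i _ => hVi i]
        congr 1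
        refine Finset.sum_congr rfl fun i _ => ?_
        rw [integral_add (hgi' i) (integrable_const _), hge]
        simp

/-! ### The atoms of the clustered prior -/

lemma log_inv_pos {η : ℝ} (h0 : 0 < η) (h1 : η < 1) : 0 < Real.log η⁻¹ :=
  Real.log_pos ((one_lt_inv₀ h0).2 h1)

lemma vFactor_eq {r : ℝ} (hr : 0 < r) : vFactor r = r / (1 + r) := by
  unfold vFactor; field_simp; ring

lemma lambdaE_sq {η : ℝ} (h0 : 0 < η) (h1 : η < 1) : lambdaE η ^ 2 = 2 * Real.log η⁻¹ :=
  Real.sq_sqrt (by linarith [log_inv_pos h0 h1])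

lemma lambdaF_sq {η r : ℝ} (hr : 0 < r) (h0 : 0 < η) (h1 : η < 1) :
    lambdaF η r ^ 2 = 2 * (r / (1 + r) * Real.log η⁻¹) := by
  have h : Real.log (η ^ (-vFactor r)) = r / (1 + r) * Real.log η⁻¹ := by
    rw [Real.log_rpow h0, vFactor_eq hr, Real.log_inv]; ring
  rw [lambdaF, h, Real.sq_sqrt]
  have := log_inv_pos h0 h1
  positivity

lemma lambdaE_nonneg (η : ℝ) : 0 ≤ lambdaE η := Real.sqrt_nonneg _

lemma lambdaF_nonneg (η r : ℝ) : 0 ≤ lambdaF η r := Real.sqrt_nonneg _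

lemma lambdaF_pos {η r : ℝ} (hr : 0 < r) (h0 : 0 < η) (h1 : η < 1) : 0 < lambdaF η r := by
  refine lt_of_le_of_ne (lambdaF_nonneg _ _) fun h => ?_
  have h2 := lambdaF_sq hr h0 h1
  have := log_inv_pos h0 h1
  have : 0 < r / (1 + r) * Real.log η⁻¹ := by positivity
  rw [← h] at h2; linarith

lemma lambdaF_le_lambdaE {η r : ℝ} (hr : 0 < r) (h0 : 0 < η) (h1 : η < 1) :
    lambdaF η r ≤ lambdaE η := by
  refine le_of_sq_le_sq ?_ (lambdaE_nonneg η)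
  rw [lambdaF_sq hr h0 h1, lambdaE_sq h0 h1]
  have h2 : r / (1 + r) ≤ 1 := by rw [div_le_one (by linarith)]; linarith
  nlinarith [log_inv_pos h0 h1]

lemma one_le_clusterSize (r : ℝ) : 1 ≤ clusterSize r := Nat.le_add_right 1 _

lemma clusterSize_of_half_le {r : ℝ} (hr : 1 / 2 ≤ r) : clusterSize r = 1 := by
  simp only [clusterSize, not_lt.2 hr, if_false, add_zero]

/-- The common spacing `μ_{1K}` of the clusters. -/
noncomputable def period (η r : ℝ) : ℝ := firstAtom η r (clusterSize r)

lemma firstAtom_one {η r : ℝ} (hr : 0 < r) (h0 : 0 < η) (h1 : η < 1) :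
    firstAtom η r 1 = lambdaF η r := by
  simp [firstAtom, lambdaF_le_lambdaE hr h0 h1]

lemma firstAtom_mono {η r : ℝ} (hr : 0 < r) {k l : ℕ} (hkl : k ≤ l) :
    firstAtom η r k ≤ firstAtom η r l := by
  refine min_le_min_right _ (mul_le_mul_of_nonneg_left ?_ (lambdaF_nonneg _ _))
  exact pow_le_pow_right₀ (by linarith) (by omega)

lemma firstAtom_nonneg {η r : ℝ} (hr : 0 < r) (k : ℕ) : 0 ≤ firstAtom η r k :=
  le_min (mul_nonneg (lambdaF_nonneg _ _) (by positivity)) (lambdaE_nonneg _)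

lemma firstAtom_le_period {η r : ℝ} (hr : 0 < r) {k : ℕ} (hk : k ≤ clusterSize r) :
    firstAtom η r k ≤ period η r := firstAtom_mono hr hk

lemma lambdaF_le_firstAtom {η r : ℝ} (hr : 0 < r) (h0 : 0 < η) (h1 : η < 1) {k : ℕ} (hk : 1 ≤ k) :
    lambdaF η r ≤ firstAtom η r k := firstAtom_one hr h0 h1 ▸ firstAtom_mono hr hk

lemma lambdaF_le_period {η r : ℝ} (hr : 0 < r) (h0 : 0 < η) (h1 : η < 1) :
    lambdaF η r ≤ period η r := lambdaF_le_firstAtom hr h0 h1 (one_le_clusterSize r)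

lemma period_of_half_le {η r : ℝ} (hr : 1 / 2 ≤ r) (h0 : 0 < η) (h1 : η < 1) :
    period η r = lambdaF η r := by
  rw [period, clusterSize_of_half_le hr, firstAtom_one (by linarith) h0 h1]

/-- For `r < 1/2` the cluster size is just large enough for the geometric progression started at
`λ_f` to reach `λ_e`. -/
lemma period_of_lt_half {η r : ℝ} (hr : 0 < r) (hr2 : r < 1 / 2) (h0 : 0 < η) (h1 : η < 1) :
    period η r = lambdaE η := by
  refine min_eq_right ?_
  have hq : 1 < 1 + 4 * r := by linarith
  have hlog := Real.log_pos hq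
  set N := ⌈Real.log (1 + r⁻¹) / (2 * Real.log (1 + 4 * r))⌉₊ with hN
  have hK : clusterSize r - 1 = N := by simp only [clusterSize, hr2, if_true]; omega
  rw [hK]
  have h2 : Real.log (1 + r⁻¹) ≤ 2 * (N * Real.log (1 + 4 * r)) := by
    have := Nat.le_ceil (Real.log (1 + r⁻¹) / (2 * Real.log (1 + 4 * r)))
    rw [← hN, div_le_iff₀ (by positivity)] at this
    linarith
  have hri : 0 < r⁻¹ := inv_pos.2 hr
  have h3 : 1 + r⁻¹ ≤ ((1 + 4 * r) ^ N) ^ 2 := by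
    rw [← Real.log_le_log_iff (by linarith) (by positivity), Real.log_pow, Real.log_pow]
    exact_mod_cast h2
  refine le_of_sq_le_sq ?_ (mul_nonneg (lambdaF_nonneg _ _) (by positivity))
  rw [mul_pow, lambdaF_sq hr h0 h1, lambdaE_sq h0 h1]
  have h4 : 1 ≤ r / (1 + r) * ((1 + 4 * r) ^ N) ^ 2 := by
    calc (1 : ℝ) = r / (1 + r) * (1 + r⁻¹) := by field_simp; ring
      _ ≤ _ := mul_le_mul_of_nonneg_left h3 (by positivity)
  nlinarith [log_inv_pos h0 h1]

lemma firstAtom_succ_le {η r : ℝ} (hr : 0 < r) {k : ℕ} (hk : 1 ≤ k) :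
    firstAtom η r (k + 1) ≤ (1 + 4 * r) * firstAtom η r k := by
  rw [firstAtom, firstAtom, mul_min_of_nonneg _ _ (by linarith : 0 ≤ 1 + 4 * r)]
  refine min_le_min ?_ (le_mul_of_one_le_left (lambdaE_nonneg _) (by linarith))
  obtain ⟨m, rfl⟩ : ∃ m, k = m + 1 := ⟨k - 1, by omega⟩
  simp only [Nat.add_sub_cancel, pow_succ]
  exact le_of_eq (by ring)

/-- `μ` is an atom of the clustered prior lying in one of the clusters `C_j`, `C_{-j}` (the origin
being the cluster of index zero). -/
def IsAtom (η r : ℝ) (j : ℕ) (μ : ℝ) : Prop :=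
  (j = 0 ∧ μ = 0) ∨ ∃ i k : ℕ, j = i + 1 ∧ 1 ≤ k ∧ k ≤ clusterSize r ∧
    (μ = i * period η r + firstAtom η r k ∨ μ = -(i * period η r + firstAtom η r k))

lemma IsAtom.neg {η r : ℝ} {j : ℕ} {μ : ℝ} (h : IsAtom η r j μ) : IsAtom η r j (-μ) := by
  rcases h with ⟨h1, h2⟩ | ⟨i, k, h1, h2, h3, h4⟩
  · exact Or.inl ⟨h1, by simp [h2]⟩
  · refine Or.inr ⟨i, k, h1, h2, h3, ?_⟩
    rcases h4 with h4 | h4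
    · exact Or.inr (by rw [h4])
    · exact Or.inl (by rw [h4, neg_neg])

lemma isAtom_mul_period (η r : ℝ) (i : ℕ) : IsAtom η r i (i * period η r) := by
  rcases i with _ | i
  · exact Or.inl ⟨rfl, by simp⟩
  · refine Or.inr ⟨i, clusterSize r, rfl, one_le_clusterSize r, le_rfl, Or.inl ?_⟩
    rw [← period]; push_cast; ring

/-! ### The deterministic inequality behind the choice of the clusters -/

lemma exists_consecutive {f : ℕ → ℝ} {t : ℝ} {N : ℕ} (h1 : f 1 < t) (hN : 1 ≤ N) (h2 : t ≤ f N) :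
    ∃ k, 1 ≤ k ∧ k + 1 ≤ N ∧ f k ≤ t ∧ t ≤ f (k + 1) := by
  induction N, hN using Nat.le_induction with
  | base => linarith
  | succ n hn ih =>
    rcases le_total t (f n) with h | h
    · obtain ⟨k, a, b, c⟩ := ih h
      exact ⟨k, a, by omega, c⟩
    · exact ⟨n, hn, le_rfl, h, h2⟩

/-- Between two points in ratio at most `1 + 4r`, the nearer one is close enough: the factor
`1 + 4r` is what makes the two parabolas cross at the level `-a²`. -/
lemma sq_sub_le_of_ratio {r a b t : ℝ} (hr : 0 < r) (ha : 0 ≤ a) (hat : a ≤ t) (htb : t ≤ b)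
    (hb : b ≤ (1 + 4 * r) * a) :
    (t - a) ^ 2 * (1 + r⁻¹) ≤ t ^ 2 - a ^ 2 ∨ (t - b) ^ 2 * (1 + r⁻¹) ≤ t ^ 2 - a ^ 2 := by
  have hri : r * r⁻¹ = 1 := mul_inv_cancel₀ hr.ne'
  have hri0 : 0 < r⁻¹ := inv_pos.2 hr
  rcases le_total t ((1 + 2 * r) * a) with h | h
  · left
    have h1 : (t - a) * r⁻¹ ≤ 2 * a := by
      calc (t - a) * r⁻¹ ≤ (2 * r * a) * r⁻¹ :=
            mul_le_mul_of_nonneg_right (by linarith) hri0.le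
        _ = 2 * a * (r * r⁻¹) := by ring
        _ = 2 * a := by rw [hri, mul_one]
    nlinarith [mul_le_mul_of_nonneg_left h1 (sub_nonneg.2 hat)]
  · right
    have h1 : (t - b) ^ 2 ≤ (2 * r * a) ^ 2 := by
      apply sq_le_sq'
      · nlinarith
      · nlinarith [mul_nonneg hr.le ha]
    have h2 : (2 * r * a) ^ 2 * (1 + r⁻¹) = ((1 + 2 * r) * a) ^ 2 - a ^ 2 := by
      calc (2 * r * a) ^ 2 * (1 + r⁻¹) = 4 * r ^ 2 * a ^ 2 + 4 * r * a ^ 2 * (r * r⁻¹) := by ring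
        _ = _ := by rw [hri]; ring
    have h3 : ((1 + 2 * r) * a) ^ 2 ≤ t ^ 2 := by
      have : 0 ≤ (1 + 2 * r) * a := by positivity
      exact pow_le_pow_left₀ this h 2
    have h4 : (t - b) ^ 2 * (1 + r⁻¹) ≤ (2 * r * a) ^ 2 * (1 + r⁻¹) :=
      mul_le_mul_of_nonneg_right h1 (by linarith)
    linarith

/-- Up to `λ_e`, the origin and the first cluster suffice. -/
lemma exists_first_atom {η r t : ℝ} (hr : 0 < r) (hr2 : r < 1 / 2) (h0 : 0 < η) (h1 : η < 1)
    (ht : 0 ≤ t) (htE : t ≤ lambdaE η) :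
    t ^ 2 * (1 + r⁻¹) / 2 ≤ t ^ 2 / 2 + Real.log η⁻¹ / (1 + r) ∨
    ∃ k, 1 ≤ k ∧ k ≤ clusterSize r ∧ (t - firstAtom η r k) ^ 2 * (1 + r⁻¹) / 2 + Real.log η⁻¹ ≤
      t ^ 2 / 2 + Real.log η⁻¹ / (1 + r) := by
  have hF := lambdaF_sq hr h0 h1
  have hri : r * r⁻¹ = 1 := mul_inv_cancel₀ hr.ne'
  have hri0 : 0 < r⁻¹ := inv_pos.2 hr
  have hL := log_inv_pos h0 h1
  set L := Real.log η⁻¹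
  have e1 : r / (1 + r) * L = L - L / (1 + r) := by field_simp; ring
  have e2 : r / (1 + r) * L * r⁻¹ = L / (1 + r) := by field_simp
  rcases le_or_gt t (lambdaF η r) with h | h
  · left
    have h3 : t ^ 2 ≤ lambdaF η r ^ 2 := pow_le_pow_left₀ ht h 2
    have h4 := mul_le_mul_of_nonneg_right h3 hri0.le
    rw [hF] at h4
    linarith
  · right
    have hlast : t ≤ firstAtom η r (clusterSize r) := by
      rw [← period, period_of_lt_half hr hr2 h0 h1]; exact htE
    obtain ⟨k, hk1, hk2, hk3, hk4⟩ := exists_consecutive (f := firstAtom η r)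
      (by rwa [firstAtom_one hr h0 h1]) (one_le_clusterSize r) hlast
    have h5 : lambdaF η r ^ 2 ≤ firstAtom η r k ^ 2 :=
      pow_le_pow_left₀ (lambdaF_nonneg _ _) (lambdaF_le_firstAtom hr h0 h1 hk1) 2
    rcases sq_sub_le_of_ratio hr (firstAtom_nonneg hr k) hk3 hk4 (firstAtom_succ_le hr hk1)
      with h6 | h6
    · exact ⟨k, hk1, by omega, by linarith⟩
    · exact ⟨k + 1, by omega, hk2, by linarith⟩

/-- The quadratic comparison that handles all clusters below the one containing `t` when `r < 1/2`;
`d` counts clusters. -/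
lemma nat_sq_bound {ε : ℝ} (hε : 0 ≤ ε) (hε1 : ε ≤ 1 / 16) (d : ℕ) :
    0 ≤ (1 - ε) * (d : ℝ) ^ 2 - d + ε := by
  rcases d with _ | d
  · simpa using hε
  · have hd : (0 : ℝ) ≤ d := Nat.cast_nonneg d
    push_cast
    have : (1 - ε) * ((d : ℝ) + 1) ^ 2 - (d + 1) + ε = d * ((d + 1) - ε * (d + 2)) := by ring
    rw [this]
    exact mul_nonneg hd (by nlinarith)

/-- The analogous comparison for `r ≥ 1/2`, with `s = 1/r` and `f` the fractional part of `t` in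
units of the period. -/
lemma nat_sq_bound_of_le_two {ε s f : ℝ} (hε : 0 ≤ ε) (hε1 : ε ≤ 1 / 16) (hs : 0 ≤ s) (hs2 : s ≤ 2)
    (hf : 0 ≤ f) (hf1 : f ≤ 1) (d : ℕ) :
    (f ^ 2 + d) * (1 + s) ≤ (1 - ε) * (f + d) ^ 2 + s + 16 * ε * (1 + s) := by
  have hff : f ^ 2 ≤ f := by nlinarith
  have hεs : 0 ≤ ε * s := mul_nonneg hε hs
  have hεf : ε * f ^ 2 ≤ ε := by nlinarith
  rcases d with _ | _ | _ | d
  · norm_num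
    nlinarith [mul_nonneg hs (by linarith : 0 ≤ 1 - f ^ 2)]
  · norm_num
    nlinarith [mul_le_mul_of_nonneg_right hs2 (sq_nonneg f), mul_le_mul_of_nonneg_left hf1 hε]
  · norm_num
    nlinarith [mul_le_mul_of_nonneg_right hs2 (sq_nonneg f), mul_le_mul_of_nonneg_left hf1 hε]
  · have hd : (0 : ℝ) ≤ d := Nat.cast_nonneg d
    push_cast
    have a1 : s * (f ^ 2 + (d + 2)) ≤ 2 * (f ^ 2 + (d + 2)) :=
      mul_le_mul_of_nonneg_right hs2 (by positivity)
    have a2 : ε * (f + (d + 3)) ^ 2 ≤ ε * (d + 4) ^ 2 :=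
      mul_le_mul_of_nonneg_left (pow_le_pow_left₀ (by positivity) (by linarith) 2) hε
    have a3 : ε * (d * (d + 8)) ≤ 1 / 16 * (d * (d + 8)) :=
      mul_le_mul_of_nonneg_right hε1 (by positivity)
    have a4 : 2 * f ^ 2 ≤ 2 * (d + 3) * f := by nlinarith [mul_nonneg hd hf]
    nlinarith

lemma exists_isAtom_of_nonneg {η r ε t : ℝ} (hr : 0 < r) (h0 : 0 < η) (h1 : η < 1) (hε : 0 ≤ ε)
    (hε1 : ε ≤ 1 / 16) (ht : 0 ≤ t) :
    ∃ (j : ℕ) (μ : ℝ), IsAtom η r j μ ∧ ∀ (i : ℕ) (x : ℝ), x ≤ i * period η r →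
      (t - μ) ^ 2 * (1 + r⁻¹) / 2 + j * Real.log η⁻¹ ≤
        (1 - ε) * (t - x) ^ 2 / 2 + i * Real.log η⁻¹ +
          (Real.log η⁻¹ / (1 + r) + 16 * ε * Real.log η⁻¹) := by
  have hL := log_inv_pos h0 h1
  have hP : 0 < period η r := (lambdaF_pos hr h0 h1).trans_le (lambdaF_le_period hr h0 h1)
  have hri : r * r⁻¹ = 1 := mul_inv_cancel₀ hr.ne'
  have hri0 : 0 < r⁻¹ := inv_pos.2 hr
  obtain ⟨m, f, hf, hf1, htm⟩ : ∃ (m : ℕ) (f : ℝ), 0 ≤ f ∧ f ≤ period η r ∧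
      t = m * period η r + f := by
    refine ⟨⌊t / period η r⌋₊, t - ⌊t / period η r⌋₊ * period η r, ?_, ?_, by ring⟩
    · have := Nat.floor_le (div_nonneg ht hP.le)
      rw [le_div_iff₀ hP] at this; linarith
    · have := (Nat.lt_floor_add_one (t / period η r)).le
      rw [div_le_iff₀ hP] at this; linarith
  -- The squared distance to a point lying at least `d` periods below.
  have hdist (d i : ℕ) (x : ℝ) (hm : m = i + d) (hx : x ≤ i * period η r) :
      (f + d * period η r) ^ 2 ≤ (t - x) ^ 2 := by
    refine pow_le_pow_left₀ (by positivity) ?_ 2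
    rw [htm, hm]; push_cast; linarith
  set P := period η r with hPdef
  set L := Real.log η⁻¹
  rcases lt_or_ge r (1 / 2) with hr2 | hr2
  · have hPE := period_of_lt_half hr hr2 h0 h1
    have hPsq : P ^ 2 = 2 * L := by rw [hPdef, hPE, lambdaE_sq h0 h1]
    have hf2 : f ^ 2 ≤ 2 * L := hPsq ▸ pow_le_pow_left₀ hf hf1 2
    have main : ∃ (j : ℕ) (μ : ℝ), IsAtom η r j μ ∧
        (t - μ) ^ 2 * (1 + r⁻¹) / 2 + j * L ≤ m * L + f ^ 2 / 2 + L / (1 + r) := by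
      rcases exists_first_atom hr hr2 h0 h1 hf (hPE ▸ hf1) with h | ⟨k, hk1, hk2, h⟩
      · refine ⟨m, m * P, isAtom_mul_period η r m, ?_⟩
        rw [htm, add_sub_cancel_left]; linarith
      · refine ⟨m + 1, m * P + firstAtom η r k, Or.inr ⟨m, k, rfl, hk1, hk2, Or.inl rfl⟩, ?_⟩
        rw [htm, add_sub_add_left_eq_sub]; push_cast; linarith
    obtain ⟨j, μ, hA, hb⟩ := main
    refine ⟨j, μ, hA, fun i x hx => hb.trans ?_⟩
    have hεL : 0 ≤ ε * L := mul_nonneg hε hL.le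
    rcases Nat.lt_or_ge m i with hmi | hmi
    · have hi : (m : ℝ) + 1 ≤ i := by exact_mod_cast hmi
      have h3 := mul_le_mul_of_nonneg_right hi hL.le
      have h4 : 0 ≤ (1 - ε) * (t - x) ^ 2 := mul_nonneg (by linarith) (sq_nonneg _)
      linarith
    · obtain ⟨d, rfl⟩ := Nat.exists_eq_add_of_le hmi
      have h3 := hdist d i x rfl hx
      have h4 : f ^ 2 + (d : ℝ) ^ 2 * (2 * L) ≤ (t - x) ^ 2 := by
        have : 0 ≤ f * (d * P) := by positivity
        rw [← hPsq]; nlinarith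
      have h5 := mul_le_mul_of_nonneg_left h4 (by linarith : 0 ≤ 1 - ε)
      have h6 := mul_nonneg (nat_sq_bound hε hε1 d) hL.le
      have h7 := mul_le_mul_of_nonneg_left hf2 hε
      push_cast
      nlinarith
  · have hPF := period_of_half_le hr2 h0 h1
    have hPsq : P ^ 2 = 2 * (r / (1 + r) * L) := by rw [hPdef, hPF, lambdaF_sq hr h0 h1]
    have eL : L = P ^ 2 / 2 * (1 + r⁻¹) := by rw [hPsq]; field_simp; ring
    have eL' : L / (1 + r) = P ^ 2 / 2 * r⁻¹ := by rw [hPsq]; field_simp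
    have hs2 : r⁻¹ ≤ 2 := by
      rw [inv_le_comm₀ hr (by norm_num)]; linarith
    refine ⟨m, m * P, isAtom_mul_period η r m, fun i x hx => ?_⟩
    obtain ⟨g, hg, hg1, rfl⟩ : ∃ g, 0 ≤ g ∧ g ≤ 1 ∧ f = g * P :=
      ⟨f / P, by positivity, (div_le_one hP).2 hf1, by field_simp⟩
    have hP2 : 0 ≤ P ^ 2 / 2 := by positivity
    have hεL : 0 ≤ ε * L := mul_nonneg hε hL.le
    have hsub : t - m * P = g * P := by rw [htm]; ring
    rw [hsub]
    rcases Nat.lt_or_ge m i with hmi | hmi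
    · have hi : (m : ℝ) + 1 ≤ i := by exact_mod_cast hmi
      have h3 := mul_le_mul_of_nonneg_right hi hL.le
      have h4 : 0 ≤ (1 - ε) * (t - x) ^ 2 := mul_nonneg (by linarith) (sq_nonneg _)
      have h5 : (g * P) ^ 2 * (1 + r⁻¹) / 2 ≤ L := by
        have : g ^ 2 ≤ 1 := by nlinarith
        have e : (g * P) ^ 2 * (1 + r⁻¹) / 2 = g ^ 2 * L := by rw [eL]; ring
        rw [e]; nlinarith
      have h6 : 0 ≤ L / (1 + r) := by positivity
      linarith
    · obtain ⟨d, rfl⟩ := Nat.exists_eq_add_of_le hmi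
      have h3 := mul_le_mul_of_nonneg_left (hdist d i x rfl hx) (by linarith : 0 ≤ 1 - ε)
      have h4 := mul_le_mul_of_nonneg_left
        (nat_sq_bound_of_le_two hε hε1 hri0.le hs2 hg hg1 d) hP2
      push_cast
      have e1 : P ^ 2 / 2 * ((g ^ 2 + d) * (1 + r⁻¹)) = (g * P) ^ 2 * (1 + r⁻¹) / 2 + d * L := by
        rw [eL]; ring
      have e2 : P ^ 2 / 2 * ((1 - ε) * (g + d) ^ 2 + r⁻¹ + 16 * ε * (1 + r⁻¹)) =
          (1 - ε) * (g * P + d * P) ^ 2 / 2 + (L / (1 + r) + 16 * ε * L) := by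
        rw [eL', eL]; ring
      rw [e1, e2] at h4
      linarith

/-- For every `t` some atom `μ` is such that the penalised squared distance of `t` to `μ`, in the
combined variance of past and future, exceeds by at most `log η⁻¹ / (1 + r)` the smallest penalised
squared distance of `t` to the prior in the variance of the past; the latter distances may be
shrunk by `1 - ε` at a cost proportional to `ε`. -/
theorem exists_isAtom {η r ε : ℝ} (hr : 0 < r) (h0 : 0 < η) (h1 : η < 1) (hε : 0 ≤ ε)
    (hε1 : ε ≤ 1 / 16) (t : ℝ) :
    ∃ (j : ℕ) (μ : ℝ), IsAtom η r j μ ∧ ∀ (i : ℕ) (x : ℝ), |x| ≤ i * period η r →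
      (t - μ) ^ 2 * (1 + r⁻¹) / 2 + j * Real.log η⁻¹ ≤
        (1 - ε) * (t - x) ^ 2 / 2 + i * Real.log η⁻¹ +
          (Real.log η⁻¹ / (1 + r) + 16 * ε * Real.log η⁻¹) := by
  rcases le_total 0 t with ht | ht
  · obtain ⟨j, μ, hA, h⟩ := exists_isAtom_of_nonneg hr h0 h1 hε hε1 ht
    exact ⟨j, μ, hA, fun i x hx => h i x ((le_abs_self x).trans hx)⟩
  · obtain ⟨j, μ, hA, h⟩ := exists_isAtom_of_nonneg hr h0 h1 hε hε1 (neg_nonneg.2 ht)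
    refine ⟨j, -μ, hA.neg, fun i x hx => ?_⟩
    have h3 := h i (-x) ((neg_le_abs x).trans hx)
    have e1 : (-t - μ) ^ 2 = (t - -μ) ^ 2 := by ring
    have e2 : (-t - -x) ^ 2 = (t - x) ^ 2 := by ring
    rwa [e1, e2] at h3

/-! ### Integration against the clustered prior -/

lemma atom_pos (η r : ℝ) (i k : ℕ) :
    atom η r ((i : ℤ) + 1) k = i * period η r + firstAtom η r k := by
  have h : ((i : ℤ) + 1).sign = 1 := Int.sign_eq_one_of_pos (by omega)
  have h2 : |(i : ℤ) + 1| = i + 1 := abs_of_pos (by omega)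
  rw [atom, h, h2, period]; push_cast; ring

lemma atom_neg (η r : ℝ) (i k : ℕ) :
    atom η r (-((i : ℤ) + 1)) k = -(i * period η r + firstAtom η r k) := by
  rw [← atom_pos, atom, atom, Int.sign_neg, abs_neg]; push_cast; ring

lemma lintegral_clusterPrior (η r : ℝ) (f : ℝ → ℝ≥0∞) :
    ∫⁻ μ, f μ ∂clusterPrior η r = ENNReal.ofReal (1 - η) * f 0 +
      ENNReal.ofReal ((1 - η) / 2) * ∑' i : ℕ, ENNReal.ofReal (η ^ (i + 1)) *
        ((clusterSize r : ℝ≥0∞)⁻¹ * (∑ k ∈ Finset.Icc 1 (clusterSize r),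
            f (i * period η r + firstAtom η r k)) +
          (clusterSize r : ℝ≥0∞)⁻¹ * (∑ k ∈ Finset.Icc 1 (clusterSize r),
            f (-(i * period η r + firstAtom η r k)))) := by
  simp only [clusterPrior, cluster, lintegral_add_measure, lintegral_smul_measure,
    lintegral_dirac, lintegral_sum_measure, lintegral_finsetSum_measure, smul_eq_mul, atom_pos,
    atom_neg]

lemma inv_clusterSize_mul_sum_le (r : ℝ) {f : ℕ → ℝ≥0∞} {c : ℝ≥0∞}
    (h : ∀ k, 1 ≤ k → k ≤ clusterSize r → f k ≤ c) :
    (clusterSize r : ℝ≥0∞)⁻¹ * ∑ k ∈ Finset.Icc 1 (clusterSize r), f k ≤ c := by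
  have hK : (clusterSize r : ℝ≥0∞) ≠ 0 := by
    have := one_le_clusterSize r
    exact_mod_cast (by omega : clusterSize r ≠ 0)
  calc (clusterSize r : ℝ≥0∞)⁻¹ * ∑ k ∈ Finset.Icc 1 (clusterSize r), f k
      ≤ (clusterSize r : ℝ≥0∞)⁻¹ * ∑ _k ∈ Finset.Icc 1 (clusterSize r), c := by
        gcongr with k hk
        exact h k (Finset.mem_Icc.1 hk).1 (Finset.mem_Icc.1 hk).2
    _ = c := by
        rw [Finset.sum_const, Nat.card_Icc, Nat.add_sub_cancel, nsmul_eq_mul, ← mul_assoc,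
          ENNReal.inv_mul_cancel hK (ENNReal.natCast_ne_top _), one_mul]

lemma isProbabilityMeasure_clusterPrior {η : ℝ} (h0 : 0 < η) (h1 : η < 1) (r : ℝ) :
    IsProbabilityMeasure (clusterPrior η r) := by
  refine ⟨?_⟩
  have h := lintegral_clusterPrior η r fun _ => 1
  have hK : (clusterSize r : ℝ≥0∞) ≠ 0 := by
    have := one_le_clusterSize r
    exact_mod_cast (by omega : clusterSize r ≠ 0)
  have hone : (clusterSize r : ℝ≥0∞)⁻¹ * (∑ _k ∈ Finset.Icc 1 (clusterSize r), 1) = 1 := by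
    rw [Finset.sum_const, Nat.card_Icc, Nat.add_sub_cancel, nsmul_eq_mul, mul_one,
      ENNReal.inv_mul_cancel hK (ENNReal.natCast_ne_top _)]
  have hs : HasSum (fun i : ℕ => η ^ (i + 1)) (η / (1 - η)) := by
    have := (hasSum_geometric_of_lt_one h0.le h1).mul_left η
    simpa [pow_succ, mul_comm, div_eq_mul_inv] using this
  have hsum : ∑' i : ℕ, ENNReal.ofReal (η ^ (i + 1)) = ENNReal.ofReal (η / (1 - η)) := by
    rw [← hs.tsum_eq, ENNReal.ofReal_tsum_of_nonneg (fun i => by positivity) hs.summable]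
  rw [hone, ENNReal.tsum_mul_right, hsum, lintegral_const, one_mul] at h
  have hpos : 0 < 1 - η := by linarith
  have htwo : (1 + 1 : ℝ≥0∞) = ENNReal.ofReal 2 := by norm_num
  rw [h, htwo, mul_one, ← ENNReal.ofReal_mul (by positivity), ← ENNReal.ofReal_mul (by positivity),
    ← ENNReal.ofReal_add hpos.le (by positivity)]
  have : 1 - η + (1 - η) / 2 * (η / (1 - η) * 2) = 1 := by field_simp; ring
  rw [this, ENNReal.ofReal_one]

lemma lintegral_clusterPrior_le {η r : ℝ} (h0 : 0 < η) (h1 : η < 1) {f : ℝ → ℝ≥0∞}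
    {b : ℕ → ℝ≥0∞} (h : ∀ j μ, IsAtom η r j μ → ENNReal.ofReal (η ^ j) * f μ ≤ b j) :
    ∫⁻ μ, f μ ∂clusterPrior η r ≤ ∑' j, b j := by
  rw [lintegral_clusterPrior, tsum_eq_zero_add' (f := b) ENNReal.summable, ← ENNReal.tsum_mul_left]
  have hb0 : f 0 ≤ b 0 := by simpa using h 0 0 (Or.inl ⟨rfl, rfl⟩)
  refine add_le_add ?_ (ENNReal.tsum_le_tsum fun i => ?_)
  · refine (mul_le_of_le_one_left (zero_le) ?_).trans hb0
    rw [ENNReal.ofReal_le_one]; linarith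
  · have hp := inv_clusterSize_mul_sum_le r
      (f := fun k => ENNReal.ofReal (η ^ (i + 1)) * f (i * period η r + firstAtom η r k))
      fun k hk1 hk2 => h (i + 1) _ (Or.inr ⟨i, k, rfl, hk1, hk2, Or.inl rfl⟩)
    have hn := inv_clusterSize_mul_sum_le r
      (f := fun k => ENNReal.ofReal (η ^ (i + 1)) * f (-(i * period η r + firstAtom η r k)))
      fun k hk1 hk2 => h (i + 1) _ (Or.inr ⟨i, k, rfl, hk1, hk2, Or.inr rfl⟩)
    rw [← Finset.mul_sum, mul_left_comm] at hp hn
    rw [mul_add]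
    calc _ ≤ ENNReal.ofReal ((1 - η) / 2) * (b (i + 1) + b (i + 1)) := by gcongr
      _ = ENNReal.ofReal (1 - η) * b (i + 1) := by
          rw [← two_mul, ← mul_assoc, show (2 : ℝ≥0∞) = ENNReal.ofReal 2 by norm_num,
            ← ENNReal.ofReal_mul (by linarith)]
          congr 2; ring
      _ ≤ b (i + 1) := mul_le_of_le_one_left (zero_le) (by
          rw [ENNReal.ofReal_le_one]; linarith)

lemma le_lintegral_clusterPrior {η r : ℝ} (h0 : 0 < η) (h1 : η < 1) (f : ℝ → ℝ≥0∞) {j : ℕ} {μ : ℝ}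
    (h : IsAtom η r j μ) :
    ENNReal.ofReal ((1 - η) / (2 * clusterSize r) * η ^ j) * f μ ≤ ∫⁻ x, f x ∂clusterPrior η r := by
  have hK1 : (1 : ℝ) ≤ clusterSize r := by exact_mod_cast one_le_clusterSize r
  have hpos : 0 < 1 - η := by linarith
  rw [lintegral_clusterPrior]
  rcases h with ⟨rfl, rfl⟩ | ⟨i, k, rfl, hk1, hk2, h⟩
  · refine le_trans ?_ le_self_add
    gcongr
    rw [pow_zero, mul_one]
    exact div_le_self hpos.le (by linarith)
  · refine le_trans ?_ le_add_self
    have hw : ENNReal.ofReal ((1 - η) / (2 * clusterSize r) * η ^ (i + 1)) =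
        ENNReal.ofReal ((1 - η) / 2) * (ENNReal.ofReal (η ^ (i + 1)) *
          (clusterSize r : ℝ≥0∞)⁻¹) := by
      rw [← ENNReal.ofReal_natCast, ← ENNReal.ofReal_inv_of_pos (by linarith),
        ← ENNReal.ofReal_mul (by positivity), ← ENNReal.ofReal_mul (by positivity)]
      congr 1; field_simp
    rw [hw, mul_assoc]
    refine mul_le_mul_right ?_ _
    refine le_trans ?_ (ENNReal.le_tsum i)
    rw [mul_assoc]
    refine mul_le_mul_right ?_ _
    have hmem : k ∈ Finset.Icc 1 (clusterSize r) := Finset.mem_Icc.2 ⟨hk1, hk2⟩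
    rcases h with rfl | rfl
    · refine le_trans (mul_le_mul_right ?_ _) le_self_add
      exact Finset.single_le_sum (f := fun k => f (i * period η r + firstAtom η r k))
        (fun _ _ => zero_le) hmem
    · refine le_trans (mul_le_mul_right ?_ _) le_add_self
      exact Finset.single_le_sum (f := fun k => f (-(i * period η r + firstAtom η r k)))
        (fun _ _ => zero_le) hmem

lemma exists_tsum_exp_neg_abs_le :
    ∃ C : ℝ, ∀ u : ℝ, ∑' i : ℕ, ENNReal.ofReal (Real.exp (-|(i : ℝ) - u|)) ≤
      ENNReal.ofReal (Real.exp C) := by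
  have hs : Summable fun z : ℤ => Real.exp (-|(z : ℝ)|) := by
    have h1 : Summable fun n : ℕ => Real.exp (-(n : ℝ)) := Real.summable_exp_neg_nat
    refine Summable.of_nat_of_neg ?_ ?_
    · simpa using h1
    · simpa using h1
  set D := ∑' z : ℤ, Real.exp (-|(z : ℝ)|) with hD
  have hDpos : 0 < D := hs.tsum_pos (fun _ => (Real.exp_pos _).le) 0 (Real.exp_pos _)
  refine ⟨1 + Real.log D, fun u => ?_⟩
  have hD' : ∑' z : ℤ, ENNReal.ofReal (Real.exp (-|(z : ℝ)|)) = ENNReal.ofReal D :=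
    (ENNReal.ofReal_tsum_of_nonneg (fun _ => (Real.exp_pos _).le) hs).symm
  calc ∑' i : ℕ, ENNReal.ofReal (Real.exp (-|(i : ℝ) - u|))
      ≤ ∑' i : ℕ, ENNReal.ofReal (Real.exp 1) *
          ENNReal.ofReal (Real.exp (-|(((i : ℤ) - ⌊u⌋ : ℤ) : ℝ)|)) := by
        refine ENNReal.tsum_le_tsum fun i => ?_
        rw [← ENNReal.ofReal_mul (Real.exp_pos _).le, ← Real.exp_add]
        refine ENNReal.ofReal_le_ofReal (Real.exp_le_exp.2 ?_)
        have h1 : |u - ⌊u⌋| ≤ 1 := by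
          rw [abs_of_nonneg (by linarith [Int.floor_le u])]
          linarith [Int.lt_floor_add_one u]
        have h2 := abs_add_le ((i : ℝ) - u) (u - ⌊u⌋)
        rw [sub_add_sub_cancel] at h2
        push_cast
        linarith
    _ = ENNReal.ofReal (Real.exp 1) *
          ∑' i : ℕ, ENNReal.ofReal (Real.exp (-|(((i : ℤ) - ⌊u⌋ : ℤ) : ℝ)|)) :=
        ENNReal.tsum_mul_left
    _ ≤ ENNReal.ofReal (Real.exp 1) * ENNReal.ofReal D := by
        rw [← hD']
        refine mul_le_mul_right ?_ _
        refine ENNReal.tsum_comp_le_tsum_of_injective (f := fun i : ℕ => (i : ℤ) - ⌊u⌋) ?_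
          fun z : ℤ => ENNReal.ofReal (Real.exp (-|(z : ℝ)|))
        intro a b hab
        simpa using hab
    _ = _ := by
        rw [← ENNReal.ofReal_mul (Real.exp_pos _).le, Real.exp_add, Real.exp_log hDpos]

lemma IsAtom.abs_mem_Icc {η r : ℝ} (hr : 0 < r) {j : ℕ} {μ : ℝ} (h : IsAtom η r j μ) :
    |μ| ≤ j * period η r ∧ (j - 1) * period η r ≤ |μ| := by
  have hP : 0 ≤ period η r := firstAtom_nonneg hr _
  rcases h with ⟨rfl, rfl⟩ | ⟨i, k, rfl, hk1, hk2, h⟩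
  · simpa using hP
  · have h2 := firstAtom_nonneg (η := η) hr k
    have h3 := firstAtom_le_period (η := η) hr hk2
    have h4 : |μ| = i * period η r + firstAtom η r k := by
      have : 0 ≤ i * period η r + firstAtom η r k := by positivity
      rcases h with rfl | rfl
      · exact abs_of_nonneg this
      · rw [abs_neg, abs_of_nonneg this]
    rw [h4]; push_cast
    constructor <;> linarith

lemma IsAtom.le_abs_sub {η r : ℝ} (hr : 0 < r) (hP : 1 ≤ period η r) {j : ℕ} {μ : ℝ}
    (h : IsAtom η r j μ) (t : ℝ) : abs (j - |t| / period η r) - 1 ≤ |t - μ| := by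
  obtain ⟨h1, h2⟩ := h.abs_mem_Icc hr
  have h3 : abs (|t| - |μ|) ≤ |t - μ| := abs_abs_sub_abs_le t μ
  set P := period η r
  have hP0 : 0 < P := by linarith
  rcases le_or_gt (abs (j - |t| / P)) 1 with h4 | h4
  · linarith [abs_nonneg (t - μ)]
  · have h5 : abs (j - |t| / P) * P = abs (j * P - |t|) := by
      nth_rw 2 [← abs_of_pos hP0]
      rw [← abs_mul, sub_mul, div_mul_cancel₀ _ hP0.ne']
    have h6 : abs (j * P - |t|) ≤ abs (|t| - |μ|) + P := by
      have h7 := abs_sub_le (j * P) |μ| |t|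
      have h8 : abs (j * P - |μ|) ≤ P := abs_le.2 ⟨by linarith, by linarith⟩
      rw [abs_sub_comm |t| |μ|]
      linarith
    nlinarith

/-- The marginal mass near `t`, with the exponent shrunk by `1 - ε / 2`, is controlled by a single
atom: the deterministic inequality is applied with exponents shrunk by `1 - ε`, and the remaining
`ε / 2` pays for summing over all atoms. -/
theorem exists_isAtom_lintegral_le {r ε : ℝ} (hr : 0 < r) (hε : 0 < ε) (hε1 : ε ≤ 1 / 16) :
    ∃ C : ℝ, ∀ η : ℝ, 0 < η → η < 1 → 1 ≤ period η r → ∀ t : ℝ, ∃ (j : ℕ) (μ : ℝ), IsAtom η r j μ ∧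
      ∫⁻ x, ENNReal.ofReal (Real.exp (-((1 - ε / 2) * (t - x) ^ 2 / 2))) ∂clusterPrior η r ≤
        ENNReal.ofReal (Real.exp (Real.log η⁻¹ / (1 + r) + 16 * ε * Real.log η⁻¹ + C -
          ((t - μ) ^ 2 * (1 + r⁻¹) / 2 + j * Real.log η⁻¹))) := by
  obtain ⟨C, hC⟩ := exists_tsum_exp_neg_abs_le
  refine ⟨C + (1 / ε + 1), fun η h0 h1 hP t => ?_⟩
  obtain ⟨j, μ, hA, h⟩ := exists_isAtom hr h0 h1 hε.le hε1 t
  refine ⟨j, μ, hA, ?_⟩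
  set L := Real.log η⁻¹ with hL
  set S := (t - μ) ^ 2 * (1 + r⁻¹) / 2 + j * L
  set E := L / (1 + r) + 16 * ε * L + (1 / ε + 1) - S with hE
  have hterm (i : ℕ) (x : ℝ) (hx : IsAtom η r i x) :
      ENNReal.ofReal (η ^ i) * ENNReal.ofReal (Real.exp (-((1 - ε / 2) * (t - x) ^ 2 / 2))) ≤
        ENNReal.ofReal (Real.exp E) *
          ENNReal.ofReal (Real.exp (-abs (i - |t| / period η r))) := by
    have hpow : η ^ i = Real.exp (-(i * L)) := by
      rw [hL, Real.log_inv, mul_neg, neg_neg, Real.exp_nat_mul, Real.exp_log h0]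
    rw [← ENNReal.ofReal_mul (by positivity), ← ENNReal.ofReal_mul (by positivity), hpow,
      ← Real.exp_add, ← Real.exp_add]
    refine ENNReal.ofReal_le_ofReal (Real.exp_le_exp.2 ?_)
    have h3 := h i x (hx.abs_mem_Icc hr).1
    have h4 := hx.le_abs_sub hr hP t
    have h5 : |t - x| ≤ ε / 4 * (t - x) ^ 2 + 1 / ε := by
      have : 0 ≤ ε * (|t - x| / 2 - 1 / ε) ^ 2 := by positivity
      have e : ε * (|t - x| / 2 - 1 / ε) ^ 2 = ε / 4 * |t - x| ^ 2 - |t - x| + 1 / ε := by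
        field_simp; ring
      rw [sq_abs] at e; linarith
    rw [hE]
    linarith
  refine (lintegral_clusterPrior_le h0 h1 hterm).trans ?_
  rw [ENNReal.tsum_mul_left]
  refine (mul_le_mul_right (hC _) _).trans (le_of_eq ?_)
  rw [← ENNReal.ofReal_mul (by positivity), ← Real.exp_add, hE]
  congr 2; ring

/-! ### The univariate risk of the clustered prior -/

lemma integrable_sub_sq_gaussianReal (t : ℝ) (v : ℝ≥0) (m : ℝ) :
    Integrable (fun x => (x - m) ^ 2) (gaussianReal t v) :=
  ((memLp_id_gaussianReal' 2 (by simp)).sub (memLp_const m)).integrable_sq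

lemma integral_sub_sq_gaussianReal (t : ℝ) (v : ℝ≥0) (m : ℝ) :
    ∫ x, (x - m) ^ 2 ∂gaussianReal t v = (t - m) ^ 2 + v := by
  have h1 : Integrable (fun x : ℝ => x) (gaussianReal t v) :=
    (memLp_id_gaussianReal' 1 (by simp)).integrable le_rfl
  have h2 : ∫ x, (x - t) ^ 2 ∂gaussianReal t v = v := by
    have := variance_fun_id_gaussianReal (μ := t) (v := v)
    rwa [variance_eq_integral measurable_id'.aemeasurable, integral_id_gaussianReal] at this
  have h3 : Integrable (fun x : ℝ => 2 * (t - m) * (x - t)) (gaussianReal t v) :=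
    (h1.sub (integrable_const t)).const_mul _
  have h4 : Integrable (fun x : ℝ => (t - m) ^ 2) (gaussianReal t v) := integrable_const _
  have e : (fun x : ℝ => (x - m) ^ 2) =
      fun x => (x - t) ^ 2 + 2 * (t - m) * (x - t) + (t - m) ^ 2 := by ext x; ring
  have h5 : Integrable (fun x : ℝ => (x - t) ^ 2 + 2 * (t - m) * (x - t)) (gaussianReal t v) :=
    (integrable_sub_sq_gaussianReal t v t).add h3
  rw [e, integral_add h5 h4, integral_add (integrable_sub_sq_gaussianReal t v t) h3, h2, integral_const_mul,
    integral_sub h1 (integrable_const t), integral_id_gaussianReal]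
  simp; ring

/-- The clustered prior in the units of the data. -/
noncomputable def scaledPrior (η : ℝ) (vx vy : ℝ≥0) : Measure ℝ :=
  (clusterPrior η ((vy : ℝ) / vx)).map fun t => √(vx : ℝ) * t

lemma isProbabilityMeasure_scaledPrior {η : ℝ} (h0 : 0 < η) (h1 : η < 1) (vx vy : ℝ≥0) :
    IsProbabilityMeasure (scaledPrior η vx vy) := by
  have := isProbabilityMeasure_clusterPrior h0 h1 ((vy : ℝ) / vx)
  exact Measure.isProbabilityMeasure_map (by fun_prop)

lemma lintegral_scaledPrior (η : ℝ) (vx vy : ℝ≥0) {f : ℝ → ℝ≥0∞} (hf : Measurable f) :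
    ∫⁻ μ, f μ ∂scaledPrior η vx vy = ∫⁻ μ, f (√(vx : ℝ) * μ) ∂clusterPrior η ((vy : ℝ) / vx) :=
  lintegral_map hf (by fun_prop)

/-- The logarithm of the ratio of the true future density, with mean `t`, to the univariate
estimate is at most `g x + h y`, the mean of which is at most `b`. -/
def HasRiskBound (η : ℝ) (vx vy : ℝ≥0) (t b : ℝ) : Prop :=
  ∃ g h : ℝ → ℝ, Measurable h ∧ Integrable g (gaussianReal t vx) ∧
    Integrable h (gaussianReal t vy) ∧
    (∀ x y, gaussianPDF t vy y ≤ ENNReal.ofReal (Real.exp (g x + h y)) *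
      (jointDensity (scaledPrior η vx vy) vx vy x y / marginal (scaledPrior η vx vy) vx x)) ∧
    ∫ x, g x ∂gaussianReal t vx + ∫ y, h y ∂gaussianReal t vy ≤ b

lemma isPredictiveDensity_clusterEstimate {η : ℝ} (h0 : 0 < η) (h1 : η < 1) {vx vy : ℝ≥0}
    (hvx : vx ≠ 0) (hvy : vy ≠ 0) (n : ℕ) : IsPredictiveDensity (clusterEstimate n η vx vy) := by
  have := isProbabilityMeasure_scaledPrior h0 h1 vx vy
  exact isPredictiveDensity_bayesEstimate hvx hvy (Measure.pi fun _ : Fin n => scaledPrior η vx vy)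

lemma predictiveRisk_clusterEstimate_le {η : ℝ} (h0 : 0 < η) (h1 : η < 1) {vx vy : ℝ≥0}
    (hvx : vx ≠ 0) (hvy : vy ≠ 0) {n : ℕ} (θ b : Fin n → ℝ)
    (hb : ∀ i, HasRiskBound η vx vy (θ i) (b i)) :
    predictiveRisk vx vy (clusterEstimate n η vx vy) θ ≤ ENNReal.ofReal (∑ i, b i) := by
  have := isProbabilityMeasure_scaledPrior h0 h1 vx vy
  choose g h hh hgi hhi hle hint using hb
  have hprod (x y : Fin n → ℝ) : clusterEstimate n η vx vy x y =
      ∏ i, jointDensity (scaledPrior η vx vy) vx vy (x i) (y i) /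
        marginal (scaledPrior η vx vy) vx (x i) :=
    bayesEstimate_pi (scaledPrior η vx vy) hvx vy x y
  refine (predictiveRisk_le_sum (q := fun x y => jointDensity (scaledPrior η vx vy) vx vy x y /
    marginal (scaledPrior η vx vy) vx x) hvy (isPredictiveDensity_clusterEstimate h0 h1 hvx hvy n)
    hprod θ hh hgi hhi hle).trans ?_
  exact ENNReal.ofReal_le_ofReal (Finset.sum_le_sum fun i _ => hint i)

lemma jointDensity_scaledPrior (η : ℝ) (vx vy : ℝ≥0) (x y : ℝ) :
    jointDensity (scaledPrior η vx vy) vx vy x y =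
      ∫⁻ μ, gaussianPDF (√(vx : ℝ) * μ) vx x * gaussianPDF (√(vx : ℝ) * μ) vy y
        ∂clusterPrior η ((vy : ℝ) / vx) :=
  lintegral_scaledPrior η vx vy
    ((measurable_gaussianPDF_mean vx x).mul (measurable_gaussianPDF_mean vy y))

lemma le_jointDensity {η : ℝ} (h0 : 0 < η) (h1 : η < 1) (vx vy : ℝ≥0) {j : ℕ} {μ : ℝ}
    (h : IsAtom η ((vy : ℝ) / vx) j μ) (x y : ℝ) :
    ENNReal.ofReal ((1 - η) / (2 * clusterSize ((vy : ℝ) / vx)) * η ^ j) *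
      (gaussianPDF (√(vx : ℝ) * μ) vx x * gaussianPDF (√(vx : ℝ) * μ) vy y) ≤
    jointDensity (scaledPrior η vx vy) vx vy x y := by
  rw [jointDensity_scaledPrior]
  exact le_lintegral_clusterPrior h0 h1
    (fun μ => gaussianPDF (√(vx : ℝ) * μ) vx x * gaussianPDF (√(vx : ℝ) * μ) vy y) h

/-- At the origin the risk is at most `-log (1 - η)`: the joint density is bounded below by the
contribution of the atom at the origin, and the marginal density of the past integrates to one. -/
theorem hasRiskBound_zero {η : ℝ} (h0 : 0 < η) (h1 : η < 1) {vx vy : ℝ≥0}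
    (hvx : vx ≠ 0) : HasRiskBound η vx vy 0 (-Real.log (1 - η)) := by
  have := isProbabilityMeasure_scaledPrior h0 h1 vx vy
  set π := scaledPrior η vx vy with hπ
  have hpos : 0 < 1 - η := by linarith
  have hφ (x : ℝ) : 0 < gaussianPDFReal 0 vx x := gaussianPDFReal_pos 0 vx x hvx
  have hfin : ∫⁻ x, marginal π vx x ≠ ∞ := by rw [lintegral_marginal π hvx]; simp
  have hmi : Integrable fun x => (marginal π vx x).toReal :=
    integrable_toReal_of_lintegral_ne_top (measurable_marginal π vx).aemeasurable hfin
  have hm1 : ∫ x, (marginal π vx x).toReal = 1 := by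
    rw [integral_toReal (measurable_marginal π vx).aemeasurable
      (ae_of_all _ fun x => (marginal_ne_top π vx x).lt_top), lintegral_marginal π hvx]
    simp
  have hcancel : (fun x =>
      gaussianPDFReal 0 vx x • ((marginal π vx x).toReal / gaussianPDFReal 0 vx x)) = fun x => (marginal π vx x).toReal := by
    ext x; rw [smul_eq_mul, mul_div_cancel₀ _ (hφ x).ne']
  have hq1 : ∫ x, (marginal π vx x).toReal / gaussianPDFReal 0 vx x ∂gaussianReal 0 vx = 1 := by
    rw [integral_gaussianReal_eq_integral_smul hvx, hcancel, hm1]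
  have hqi : Integrable (fun x => (marginal π vx x).toReal / gaussianPDFReal 0 vx x)
      (gaussianReal 0 vx) := by
    rw [gaussianReal_of_var_ne_zero _ hvx, integrable_withDensity_iff_integrable_smul'
      (measurable_gaussianPDF 0 vx) (ae_of_all _ fun x => gaussianPDF_lt_top)]
    simp_rw [toReal_gaussianPDF]
    rw [hcancel]; exact hmi
  have hgi : Integrable (fun x => -Real.log (1 - η) +
      ((marginal π vx x).toReal / gaussianPDFReal 0 vx x - 1)) (gaussianReal 0 vx) :=
    (integrable_const _).add (hqi.sub (integrable_const _))
  refine ⟨fun x => -Real.log (1 - η) + ((marginal π vx x).toReal / gaussianPDFReal 0 vx x - 1),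
    fun _ => 0, measurable_const, hgi, integrable_zero _ _ _, fun x y => ?_, le_of_eq ?_⟩
  · have hj : ENNReal.ofReal (1 - η) * (gaussianPDF 0 vx x * gaussianPDF 0 vy y) ≤
        jointDensity π vx vy x y := by
      rw [hπ, jointDensity_scaledPrior, lintegral_clusterPrior]
      refine le_trans (le_of_eq ?_) le_self_add
      rw [mul_zero]
    rw [← mul_div_assoc, ENNReal.le_div_iff_mul_le (Or.inl (marginal_ne_zero π hvx x))
      (Or.inl (marginal_ne_top π vx x))]
    refine le_trans ?_ (mul_le_mul_right hj _)
    obtain ⟨m, hm⟩ : ∃ m, m = (marginal π vx x).toReal := ⟨_, rfl⟩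
    have hmx : marginal π vx x = ENNReal.ofReal m := by
      rw [hm, ENNReal.ofReal_toReal (marginal_ne_top π vx x)]
    beta_reduce
    rw [← hm, hmx, gaussianPDF, gaussianPDF, ← ENNReal.ofReal_mul (gaussianPDFReal_nonneg _ _ _),
      ← ENNReal.ofReal_mul (gaussianPDFReal_nonneg _ _ _), ← ENNReal.ofReal_mul hpos.le,
      ← ENNReal.ofReal_mul (Real.exp_pos _).le]
    refine ENNReal.ofReal_le_ofReal ?_
    have hexp : m / gaussianPDFReal 0 vx x ≤ Real.exp (m / gaussianPDFReal 0 vx x - 1) := by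
      linarith [Real.add_one_le_exp (m / gaussianPDFReal 0 vx x - 1)]
    rw [div_le_iff₀ (hφ x)] at hexp
    rw [add_zero, Real.exp_add, Real.exp_neg, Real.exp_log hpos]
    calc gaussianPDFReal 0 vy y * m ≤ gaussianPDFReal 0 vy y *
          (Real.exp (m / gaussianPDFReal 0 vx x - 1) * gaussianPDFReal 0 vx x) :=
          mul_le_mul_of_nonneg_left hexp (gaussianPDFReal_nonneg _ _ _)
      _ = _ := by field_simp
  · have hq' : Integrable (fun x => (marginal π vx x).toReal / gaussianPDFReal 0 vx x - 1)
        (gaussianReal 0 vx) := hqi.sub (integrable_const _)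
    rw [integral_add (integrable_const _) hq', integral_sub hqi (integrable_const _), hq1]
    simp

/-- The marginal density at `x = t + (x - t)` is compared with its exponent at `t`; completing the
square costs a factor `exp ((x - t)² / (2 δ vx))`, whose logarithm has bounded mean. -/
lemma marginal_scaledPrior_le (η : ℝ) {vx : ℝ≥0} (hvx : vx ≠ 0) (vy : ℝ≥0) {δ : ℝ} (hδ : 0 < δ)
    (t x : ℝ) :
    marginal (scaledPrior η vx vy) vx x ≤
      ENNReal.ofReal ((√(2 * Real.pi * vx))⁻¹ * Real.exp ((x - t) ^ 2 / (2 * δ * vx))) *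
      ∫⁻ μ, ENNReal.ofReal (Real.exp (-((1 - δ) * (t / √(vx : ℝ) - μ) ^ 2 / 2)))
        ∂clusterPrior η ((vy : ℝ) / vx) := by
  rw [marginal, lintegral_scaledPrior η vx vy (measurable_gaussianPDF_mean vx x),
    ← lintegral_const_mul _ (by fun_prop)]
  refine lintegral_mono fun μ => ?_
  have hv : (0 : ℝ) < vx := by positivity
  have hs : 0 < √(vx : ℝ) := Real.sqrt_pos.2 hv
  have hsv : √(vx : ℝ) ^ 2 = vx := Real.sq_sqrt hv.le
  simp only [gaussianPDF, gaussianPDFReal]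
  rw [← ENNReal.ofReal_mul (by positivity), mul_assoc (√(2 * Real.pi * (vx : ℝ)))⁻¹,
    ← Real.exp_add]
  refine ENNReal.ofReal_le_ofReal (mul_le_mul_of_nonneg_left (Real.exp_le_exp.2 ?_) (by positivity))
  have e1 : (1 - δ) * (t / √(vx : ℝ) - μ) ^ 2 / 2 =
      (1 - δ) * (t - √(vx : ℝ) * μ) ^ 2 / (2 * vx) := by
    have : t - √(vx : ℝ) * μ = √(vx : ℝ) * (t / √(vx : ℝ) - μ) := by field_simp
    rw [this, mul_pow, hsv]; field_simp
  rw [e1]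
  have h : 0 ≤ δ * ((t - √(vx : ℝ) * μ) + (x - t) / δ) ^ 2 := by positivity
  have e2 : δ * ((t - √(vx : ℝ) * μ) + (x - t) / δ) ^ 2 = δ * (t - √(vx : ℝ) * μ) ^ 2 +
      2 * (t - √(vx : ℝ) * μ) * (x - t) + (x - t) ^ 2 / δ := by field_simp; ring
  have e3 : (x - t) ^ 2 / (2 * δ * vx) + -((1 - δ) * (t - √(vx : ℝ) * μ) ^ 2 / (2 * vx)) =
      ((x - t) ^ 2 / δ - (1 - δ) * (t - √(vx : ℝ) * μ) ^ 2) / (2 * vx) := by field_simp; ring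
  rw [e3]
  refine div_le_div_of_nonneg_right ?_ (by positivity)
  rw [e2] at h
  nlinarith [sq_nonneg (x - t)]

/-- Uniformly over the mean, the univariate risk is at most `log η⁻¹ / (1 + r)` up to an arbitrarily
small multiple of `log η⁻¹` and a constant. The joint density is bounded below by the contribution
of a single atom, chosen by the deterministic inequality. -/
theorem exists_hasRiskBound {vx vy : ℝ≥0} (hvx : vx ≠ 0) (hvy : vy ≠ 0) {ε : ℝ} (hε : 0 < ε)
    (hε1 : ε ≤ 1 / 16) :
    ∃ C : ℝ, ∀ η : ℝ, 0 < η → η ≤ 1 / 2 → 1 ≤ period η ((vy : ℝ) / vx) → ∀ t : ℝ,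
      HasRiskBound η vx vy t
        (Real.log η⁻¹ / (1 + (vy : ℝ) / vx) + 16 * ε * Real.log η⁻¹ + C) := by
  have hvx' : (0 : ℝ) < vx := by positivity
  have hvy' : (0 : ℝ) < vy := by positivity
  have hr : 0 < (vy : ℝ) / vx := by positivity
  obtain ⟨C, hC⟩ := exists_isAtom_lintegral_le hr hε hε1
  have hK1 : (1 : ℝ) ≤ clusterSize ((vy : ℝ) / vx) := by exact_mod_cast one_le_clusterSize _
  refine ⟨C + Real.log (4 * clusterSize ((vy : ℝ) / vx)) + 1 / ε + 1 / 2, fun η h0 h12 hP t => ?_⟩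
  have h1 : η < 1 := by linarith
  have := isProbabilityMeasure_scaledPrior h0 h1 vx vy
  have hs : 0 < √(vx : ℝ) := Real.sqrt_pos.2 hvx'
  have hsv : √(vx : ℝ) ^ 2 = vx := Real.sq_sqrt hvx'.le
  obtain ⟨j, μ, hA, hM⟩ := hC η h0 h1 hP (t / √(vx : ℝ))
  set r := (vy : ℝ) / vx with hrdef
  set L := Real.log η⁻¹ with hL
  set K : ℝ := (clusterSize r : ℝ) with hK
  set m := √(vx : ℝ) * μ with hm
  set E := L / (1 + r) + 16 * ε * L + C -
    ((t / √(vx : ℝ) - μ) ^ 2 * (1 + r⁻¹) / 2 + j * L) with hE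
  set w := (1 - η) / (2 * K) * η ^ j with hw
  have hpos : 0 < 1 - η := by linarith
  have hw0 : 0 < w := by positivity
  have hgi : Integrable (fun x => (x - t) ^ 2 * (ε * vx)⁻¹ + (x - m) ^ 2 * (2 * vx : ℝ)⁻¹ +
      (E - Real.log w)) (gaussianReal t vx) :=
    (((integrable_sub_sq_gaussianReal t vx t).mul_const _).add
      ((integrable_sub_sq_gaussianReal t vx m).mul_const _)).add (integrable_const _)
  have hhi : Integrable (fun y => ((y - m) ^ 2 - (y - t) ^ 2) * (2 * vy : ℝ)⁻¹)
      (gaussianReal t vy) :=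
    ((integrable_sub_sq_gaussianReal t vy m).sub
      (integrable_sub_sq_gaussianReal t vy t)).mul_const _
  refine ⟨_, _, by fun_prop, hgi, hhi, fun x y => ?_, ?_⟩
  · rw [← mul_div_assoc, ENNReal.le_div_iff_mul_le (Or.inl (marginal_ne_zero _ hvx x))
      (Or.inl (marginal_ne_top _ vx x))]
    refine le_trans (mul_le_mul_right ((marginal_scaledPrior_le η hvx vy (half_pos hε) t x).trans
      (mul_le_mul_right hM _)) _) (le_trans (le_of_eq ?_)
      (mul_le_mul_right (le_jointDensity h0 h1 vx vy hA x y) _))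
    simp only [gaussianPDF, gaussianPDFReal]
    rw [← ENNReal.ofReal_mul (by positivity), ← ENNReal.ofReal_mul (by positivity),
      ← ENNReal.ofReal_mul (by positivity), ← ENNReal.ofReal_mul (by positivity),
      ← ENNReal.ofReal_mul (by positivity)]
    congr 1
    have key : Real.exp (-(y - t) ^ 2 / (2 * vy)) *
        (Real.exp ((x - t) ^ 2 / (2 * (ε / 2) * vx)) * Real.exp E) =
        Real.exp ((x - t) ^ 2 * (ε * vx)⁻¹ + (x - m) ^ 2 * (2 * vx : ℝ)⁻¹ + (E - Real.log w) +
          ((y - m) ^ 2 - (y - t) ^ 2) * (2 * vy : ℝ)⁻¹) *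
        (Real.exp (Real.log w) * (Real.exp (-(x - m) ^ 2 / (2 * vx)) *
          Real.exp (-(y - m) ^ 2 / (2 * vy)))) := by
      simp only [← Real.exp_add]
      congr 1
      field_simp
      ring
    rw [Real.exp_log hw0] at key
    linear_combination (√(2 * Real.pi * (vx : ℝ)))⁻¹ * (√(2 * Real.pi * (vy : ℝ)))⁻¹ * key
  · have i1 := (integrable_sub_sq_gaussianReal t vx t).mul_const (ε * vx : ℝ)⁻¹
    have i2 := (integrable_sub_sq_gaussianReal t vx m).mul_const (2 * vx : ℝ)⁻¹
    have i3 : Integrable (fun x => (x - t) ^ 2 * (ε * vx : ℝ)⁻¹ + (x - m) ^ 2 * (2 * vx : ℝ)⁻¹)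
      (gaussianReal t vx) := i1.add i2
    rw [integral_add i3 (integrable_const _), integral_add i1 i2, integral_mul_const,
      integral_mul_const, integral_mul_const,
      integral_sub (integrable_sub_sq_gaussianReal t vy m) (integrable_sub_sq_gaussianReal t vy t)]
    simp only [integral_sub_sq_gaussianReal, integral_const, probReal_univ, one_smul]
    have hlogw : -Real.log w ≤ Real.log (4 * K) + j * L := by
      have e1 : Real.log w = Real.log ((1 - η) / (2 * K)) - j * L := by
        rw [hw, Real.log_mul (by positivity) (by positivity), Real.log_pow, hL, Real.log_inv]
        ring
      have e2 : -Real.log ((1 - η) / (2 * K)) ≤ Real.log (4 * K) := by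
        rw [← Real.log_inv]
        refine Real.log_le_log (by positivity) ?_
        rw [inv_div, div_le_iff₀ hpos]
        nlinarith
      linarith
    have e3 : (t - m) ^ 2 = vx * (t / √(vx : ℝ) - μ) ^ 2 := by
      have : t - m = √(vx : ℝ) * (t / √(vx : ℝ) - μ) := by rw [hm]; field_simp
      rw [this, mul_pow, hsv]
    have e4 : (t - m) ^ 2 * (2 * vx : ℝ)⁻¹ + (t - m) ^ 2 * (2 * vy : ℝ)⁻¹ =
        (t / √(vx : ℝ) - μ) ^ 2 * (1 + r⁻¹) / 2 := by
      rw [e3, hrdef]; field_simp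
    have e5 : ((t - t) ^ 2 + (vx : ℝ)) * (ε * vx : ℝ)⁻¹ = 1 / ε := by field_simp; ring
    have e6 : (vx : ℝ) * (2 * vx : ℝ)⁻¹ = 1 / 2 := by field_simp
    rw [e5, hE]
    linarith

/-! ### The minimax lower bound -/

lemma ofReal_integral_le_lintegral {α : Type*} [MeasurableSpace α] {μ : Measure α} {f : α → ℝ}
    (hf : Integrable f μ) : ENNReal.ofReal (∫ a, f a ∂μ) ≤ ∫⁻ a, ENNReal.ofReal (f a) ∂μ := by
  have h : Integrable (fun a => max (f a) 0) μ := hf.pos_part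
  calc ENNReal.ofReal (∫ a, f a ∂μ) ≤ ENNReal.ofReal (∫ a, max (f a) 0 ∂μ) :=
        ENNReal.ofReal_le_ofReal (integral_mono hf h fun a => le_max_left _ _)
    _ = ∫⁻ a, ENNReal.ofReal (max (f a) 0) ∂μ :=
        ofReal_integral_eq_lintegral_ofReal h (ae_of_all _ fun a => le_max_right _ _)
    _ = _ := by simp

lemma ofReal_one_add_integral_le_klDiv_add {α : Type*} [MeasurableSpace α] {μ ν : Measure α}
    [IsFiniteMeasure μ] [IsProbabilityMeasure ν] {g : α → ℝ} (hg : Measurable g)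
    (hgi : Integrable g μ) :
    ENNReal.ofReal (1 + ∫ y, g y ∂μ) ≤
      InformationTheory.klDiv μ ν + ∫⁻ y, ENNReal.ofReal (Real.exp (g y)) ∂ν := by
  by_cases htop : InformationTheory.klDiv μ ν + ∫⁻ y, ENNReal.ofReal (Real.exp (g y)) ∂ν = ∞
  · rw [htop]; exact le_top
  have h := one_add_lintegral_le_klDiv_add (μ := μ) (ν := ν) hg
  have hp : ∫⁻ y, ENNReal.ofReal (g y) ∂μ ≠ ∞ := hgi.lintegral_lt_top.ne
  have hn : ∫⁻ y, ENNReal.ofReal (-g y) ∂μ ≠ ∞ := hgi.neg.lintegral_lt_top.ne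
  rw [ENNReal.ofReal_le_iff_le_toReal htop,
    integral_eq_lintegral_pos_part_sub_lintegral_neg_part hgi]
  have h2 := ENNReal.toReal_mono (ENNReal.add_ne_top.2 ⟨htop, hn⟩) h
  rw [ENNReal.toReal_add htop hn, ENNReal.toReal_add ENNReal.one_ne_top hp,
    ENNReal.toReal_one] at h2
  linarith

lemma integrable_comp_gaussianVec {n : ℕ} {θ : Fin n → ℝ} {v : ℝ≥0} {i : Fin n} {f : ℝ → ℝ}
    (hf : Integrable f (gaussianReal (θ i) v)) :
    Integrable (fun z => f (z i)) (gaussianVec θ v) :=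
  integrable_comp_eval (X := fun _ : Fin n => ℝ) (f := f) hf

lemma integral_comp_gaussianVec {n : ℕ} (θ : Fin n → ℝ) (v : ℝ≥0) (i : Fin n) {f : ℝ → ℝ}
    (hf : Measurable f) :
    ∫ z, f (z i) ∂gaussianVec θ v = ∫ t, f t ∂gaussianReal (θ i) v :=
  integral_comp_eval (X := fun _ : Fin n => ℝ) (f := f) hf.aestronglyMeasurable

/-- The likelihood ratio of `N(τ, v)` to `N(0, v)`. -/
noncomputable def tilt (v : ℝ≥0) (τ z : ℝ) : ℝ := Real.exp (τ * z / v - τ ^ 2 / (2 * v))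

lemma tilt_pos (v : ℝ≥0) (τ z : ℝ) : 0 < tilt v τ z := Real.exp_pos _

lemma measurable_tilt (v : ℝ≥0) (τ : ℝ) : Measurable (tilt v τ) := by unfold tilt; fun_prop

lemma gaussianPDFReal_eq_mul_tilt {v : ℝ≥0} (hv : v ≠ 0) (τ z : ℝ) :
    gaussianPDFReal τ v z = gaussianPDFReal 0 v z * tilt v τ z := by
  have hv' : (0 : ℝ) < v := by positivity
  rw [gaussianPDFReal, gaussianPDFReal, tilt, mul_assoc (√(2 * Real.pi * (v : ℝ)))⁻¹, ← Real.exp_add]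
  congr 2
  field_simp
  ring

lemma integrable_tilt (v : ℝ≥0) (τ : ℝ) : Integrable (tilt v τ) (gaussianReal 0 v) := by
  have h := (integrable_exp_mul_gaussianReal (μ := 0) (v := v) (τ / v)).mul_const
    (Real.exp (-(τ ^ 2 / (2 * v))))
  refine h.congr (ae_of_all _ fun z => ?_)
  simp only [tilt]
  rw [← Real.exp_add]
  congr 1; ring

lemma integral_tilt {v : ℝ≥0} (hv : v ≠ 0) (τ : ℝ) : ∫ z, tilt v τ z ∂gaussianReal 0 v = 1 := by
  rw [integral_gaussianReal_eq_integral_smul hv]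
  simp_rw [smul_eq_mul, ← gaussianPDFReal_eq_mul_tilt hv]
  exact integral_gaussianPDFReal_eq_one τ hv

/-- The vector with entry `τ` on the range of `e` and zero elsewhere. -/
def spikes {n s : ℕ} (e : Fin s → Fin n) (τ : ℝ) (i : Fin n) : ℝ :=
  if i ∈ Finset.univ.image e then τ else 0

lemma spikes_apply {n s : ℕ} (e : Fin s → Fin n) (τ : ℝ) (b : Fin s) : spikes e τ (e b) = τ := by
  simp [spikes]

lemma spikes_of_forall_ne {n s : ℕ} {e : Fin s → Fin n} (τ : ℝ) {i : Fin n} (h : ∀ b, e b ≠ i) :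
    spikes e τ i = 0 := by
  simp [spikes, h]

lemma spikes_mem_sparseSet {n s : ℕ} (e : Fin s → Fin n) (τ : ℝ) : spikes e τ ∈ sparseSet n s := by
  have h : (Finset.univ.filter fun i => spikes e τ i ≠ 0) ⊆ Finset.univ.image e := by
    intro i hi
    by_contra hne
    exact (Finset.mem_filter.1 hi).2 (if_neg hne)
  refine (Finset.card_le_card h).trans (Finset.card_image_le.trans ?_)
  simp

lemma prod_spikes {n s : ℕ} {e : Fin s → Fin n} (he : Function.Injective e) (τ : ℝ)
    {F : Fin n → ℝ → ℝ} (hF : ∀ i, F i 0 = 1) : ∏ i, F i (spikes e τ i) = ∏ b, F (e b) τ := by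
  calc ∏ i, F i (spikes e τ i) = ∏ i ∈ Finset.univ.image e, F i (spikes e τ i) :=
        (Finset.prod_subset (Finset.subset_univ _) fun i _ hi => by
          rw [spikes, if_neg hi, hF]).symm
    _ = ∏ b, F (e b) τ := by
        rw [Finset.prod_image fun a _ b _ h => he h]
        exact Finset.prod_congr rfl fun b _ => by rw [spikes_apply]

lemma gaussianVecPDF_spikes {n s : ℕ} {e : Fin s → Fin n} (he : Function.Injective e) (τ : ℝ)
    {v : ℝ≥0} (hv : v ≠ 0) (z : Fin n → ℝ) :
    gaussianVecPDF (spikes e τ) v z =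
      gaussianVecPDF 0 v z * ENNReal.ofReal (∏ b, tilt v τ (z (e b))) := by
  rw [gaussianVecPDF_eq_ofReal, gaussianVecPDF_eq_ofReal,
    ← ENNReal.ofReal_mul (Finset.prod_nonneg fun i _ => gaussianPDFReal_nonneg _ _ _)]
  simp_rw [fun i => gaussianPDFReal_eq_mul_tilt hv (spikes e τ i), Finset.prod_mul_distrib]
  rw [prod_spikes he τ (F := fun i t => tilt v t (z i)) fun i => by simp [tilt]]
  rfl

/-- The contribution of one block of coordinates `ι` to the test function of the variational lower
bound, when the spike of the block is at `ι k₀`. It bounds from below the logarithm of the future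
likelihood ratio of the spike minus the logarithm of the average over `k` of the joint likelihood
ratios of a spike at `ι k`. -/
noncomputable def blockScore (vx vy : ℝ≥0) (τ : ℝ) {m n : ℕ} (ι : Fin m → Fin n) (k₀ : Fin m)
    (x y : Fin n → ℝ) : ℝ :=
  (-1 - τ / vx * (1 + (x (ι k₀) - τ) ^ 2)) +
    (τ * y (ι k₀) / vy - τ ^ 2 / (2 * vy) - τ / vy * (1 + (y (ι k₀) - τ) ^ 2)) -
    (m : ℝ)⁻¹ * ∑ k ∈ Finset.univ.erase k₀, tilt vx τ (x (ι k)) * tilt vy τ (y (ι k))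

/-- Since `τ` satisfies `(1 / vx + 1 / vy) τ² / 2 = log m`, the likelihood ratio of the true spike,
divided by `m`, is the exponential of a centred linear form in the data, which the quadratic terms
of the score dominate. -/
lemma tilt_mul_exp_blockScore_le {vx vy : ℝ≥0} (hvx : vx ≠ 0) (hvy : vy ≠ 0) {τ : ℝ} (hτ : 0 ≤ τ)
    {m n : ℕ} (hτm : (1 / (vx : ℝ) + 1 / vy) * τ ^ 2 / 2 = Real.log m) (ι : Fin m → Fin n)
    (k₀ : Fin m) (x y : Fin n → ℝ) :
    tilt vx τ (x (ι k₀)) * Real.exp (blockScore vx vy τ ι k₀ x y) ≤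
      m * (tilt vx τ (x (ι k₀)) * tilt vy τ (y (ι k₀))) /
        ∑ k, tilt vx τ (x (ι k)) * tilt vy τ (y (ι k)) := by
  have hvx' : (0 : ℝ) < vx := by positivity
  have hvy' : (0 : ℝ) < vy := by positivity
  have hm : (0 : ℝ) < m := by exact_mod_cast (Fin.pos k₀)
  set T := (m : ℝ)⁻¹ * ∑ k ∈ Finset.univ.erase k₀, tilt vx τ (x (ι k)) * tilt vy τ (y (ι k))
    with hT
  have hT0 : 0 ≤ T := mul_nonneg (by positivity)
    (Finset.sum_nonneg fun k _ => (mul_pos (tilt_pos _ _ _) (tilt_pos _ _ _)).le)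
  set Q := τ / vx * (1 + (x (ι k₀) - τ) ^ 2) + τ / vy * (1 + (y (ι k₀) - τ) ^ 2) with hQ
  have hQ0 : 0 ≤ Q := by positivity
  set w := tilt vx τ (x (ι k₀)) * tilt vy τ (y (ι k₀)) with hw
  have hw0 : 0 < w := mul_pos (tilt_pos _ _ _) (tilt_pos _ _ _)
  have hsum : ∑ k, tilt vx τ (x (ι k)) * tilt vy τ (y (ι k)) = m * (w / m + T) := by
    rw [← Finset.add_sum_erase _ _ (Finset.mem_univ k₀), hT, ← hw]
    field_simp
  have hwQ : w / m ≤ Real.exp Q := by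
    have hmexp : (m : ℝ) = Real.exp ((1 / (vx : ℝ) + 1 / vy) * τ ^ 2 / 2) := by
      rw [hτm, Real.exp_log hm]
    rw [div_le_iff₀ hm, hw, tilt, tilt, ← Real.exp_add, hmexp, ← Real.exp_add]
    refine Real.exp_le_exp.2 ?_
    have ha (u : ℝ) : u ≤ 1 + u ^ 2 := by nlinarith [sq_nonneg (u - 1)]
    have h1 := mul_le_mul_of_nonneg_left (ha (x (ι k₀) - τ)) (by positivity : 0 ≤ τ / vx)
    have h2 := mul_le_mul_of_nonneg_left (ha (y (ι k₀) - τ)) (by positivity : 0 ≤ τ / vy)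
    have e : τ * x (ι k₀) / vx - τ ^ 2 / (2 * vx) + (τ * y (ι k₀) / vy - τ ^ 2 / (2 * vy)) =
        τ / vx * (x (ι k₀) - τ) + τ / vy * (y (ι k₀) - τ) +
          (1 / (vx : ℝ) + 1 / vy) * τ ^ 2 / 2 := by
      field_simp; ring
    rw [e, hQ]; linarith
  have hL : w / m + T ≤ Real.exp (1 + Q + T) := by
    have h1 : 1 ≤ Real.exp Q := Real.one_le_exp hQ0
    have h2 := Real.add_one_le_exp T
    have h3 : (1 : ℝ) ≤ Real.exp 1 := Real.one_le_exp zero_le_one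
    calc w / m + T ≤ Real.exp Q * (T + 1) := by nlinarith
      _ ≤ Real.exp Q * Real.exp T := mul_le_mul_of_nonneg_left h2 (Real.exp_pos _).le
      _ ≤ Real.exp 1 * (Real.exp Q * Real.exp T) :=
          le_mul_of_one_le_left (by positivity) h3
      _ = Real.exp (1 + Q + T) := by rw [← Real.exp_add, ← Real.exp_add, ← add_assoc]
  have hL0 : 0 < w / m + T := by positivity
  have hscore : Real.exp (blockScore vx vy τ ι k₀ x y) =
      tilt vy τ (y (ι k₀)) / Real.exp (1 + Q + T) := by
    rw [tilt, ← Real.exp_sub, blockScore]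
    congr 1
    rw [← hT, hQ]; ring
  rw [hsum, hscore, ← mul_div_assoc, ← hw, mul_div_mul_left _ _ hm.ne']
  exact div_le_div_of_nonneg_left hw0.le hL0 hL

lemma measurable_blockScore (vx vy : ℝ≥0) (τ : ℝ) {m n : ℕ} (ι : Fin m → Fin n) (k₀ : Fin m) :
    Measurable fun a : (Fin n → ℝ) × (Fin n → ℝ) => blockScore vx vy τ ι k₀ a.1 a.2 := by
  unfold blockScore
  have hx (k : Fin m) : Measurable fun a : (Fin n → ℝ) × (Fin n → ℝ) => a.1 (ι k) :=
    (measurable_pi_apply _).comp measurable_fst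
  have hy (k : Fin m) : Measurable fun a : (Fin n → ℝ) × (Fin n → ℝ) => a.2 (ι k) :=
    (measurable_pi_apply _).comp measurable_snd
  have hS : Measurable fun a : (Fin n → ℝ) × (Fin n → ℝ) =>
      ∑ k ∈ Finset.univ.erase k₀, tilt vx τ (a.1 (ι k)) * tilt vy τ (a.2 (ι k)) :=
    Finset.measurable_sum _ fun k _ =>
      ((measurable_tilt vx τ).comp (hx k)).mul ((measurable_tilt vy τ).comp (hy k))
  have h1 := hx k₀
  have h2 := hy k₀
  exact ((by fun_prop : Measurable fun a : (Fin n → ℝ) × (Fin n → ℝ) =>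
    (-1 - τ / vx * (1 + (a.1 (ι k₀) - τ) ^ 2))).add (by fun_prop)).sub (hS.const_mul _)

/-- The mean of the score of a block under the parameter with a spike at `ι k₀` and zeros elsewhere
in the block. -/
lemma integrable_integral_blockScore {vx vy : ℝ≥0} (hvx : vx ≠ 0) (hvy : vy ≠ 0) {τ : ℝ}
    {m n : ℕ} {ι : Fin m → Fin n} {k₀ : Fin m} {θ : Fin n → ℝ} (hθ : θ (ι k₀) = τ)
    (hθ0 : ∀ k ≠ k₀, θ (ι k) = 0) :
    (∀ x, Integrable (blockScore vx vy τ ι k₀ x) (gaussianVec θ vy)) ∧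
    Integrable (fun x => ∫ y, blockScore vx vy τ ι k₀ x y ∂gaussianVec θ vy) (gaussianVec θ vx) ∧
    τ ^ 2 / (2 * vy) - 2 - τ * (1 / vx + 1 / vy + 2) ≤
      ∫ x, ∫ y, blockScore vx vy τ ι k₀ x y ∂gaussianVec θ vy ∂gaussianVec θ vx := by
  have hvx' : (0 : ℝ) < vx := by positivity
  have hvy' : (0 : ℝ) < vy := by positivity
  have hm : (0 : ℝ) < m := by exact_mod_cast (Fin.pos k₀)
  -- Moments of the coordinates.
  have hti (v : ℝ≥0) (k : Fin m) (hk : k ∈ Finset.univ.erase k₀) :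
      Integrable (fun z : Fin n → ℝ => tilt v τ (z (ι k))) (gaussianVec θ v) := by
    refine integrable_comp_gaussianVec (f := tilt v τ) ?_
    rw [hθ0 k (Finset.ne_of_mem_erase hk)]; exact integrable_tilt v τ
  have ht1 (v : ℝ≥0) (hv : v ≠ 0) (k : Fin m) (hk : k ∈ Finset.univ.erase k₀) :
      ∫ z, tilt v τ (z (ι k)) ∂gaussianVec θ v = 1 := by
    rw [integral_comp_gaussianVec θ v (ι k) (measurable_tilt v τ),
      hθ0 k (Finset.ne_of_mem_erase hk), integral_tilt hv]
  have hqi (v : ℝ≥0) : Integrable (fun z : Fin n → ℝ => (z (ι k₀) - τ) ^ 2) (gaussianVec θ v) :=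
    integrable_comp_gaussianVec (f := fun t : ℝ => (t - τ) ^ 2) (integrable_sub_sq_gaussianReal _ _ _)
  have hq1 (v : ℝ≥0) : ∫ z, (z (ι k₀) - τ) ^ 2 ∂gaussianVec θ v = v := by
    rw [integral_comp_gaussianVec θ v (ι k₀) (f := fun t : ℝ => (t - τ) ^ 2) (by fun_prop),
      integral_sub_sq_gaussianReal, hθ]; ring
  have hyi : Integrable (fun z : Fin n → ℝ => z (ι k₀)) (gaussianVec θ vy) :=
    integrable_comp_gaussianVec (f := fun t : ℝ => t)
      ((memLp_id_gaussianReal' 1 (by simp)).integrable le_rfl)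
  have hy1 : ∫ z, z (ι k₀) ∂gaussianVec θ vy = τ := by
    rw [integral_comp_gaussianVec θ vy (ι k₀) (f := fun t : ℝ => t) (by fun_prop),
      integral_id_gaussianReal, hθ]
  have iA : Integrable (fun y : Fin n → ℝ => τ * y (ι k₀) / vy - τ ^ 2 / (2 * vy))
      (gaussianVec θ vy) := ((hyi.const_mul τ).div_const _).sub (integrable_const _)
  have iB (v : ℝ≥0) : Integrable (fun y : Fin n → ℝ => τ / v * (1 + (y (ι k₀) - τ) ^ 2))
      (gaussianVec θ v) := ((integrable_const 1).add (hqi v)).const_mul _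
  have vB (v : ℝ≥0) : ∫ y, τ / v * (1 + (y (ι k₀) - τ) ^ 2) ∂gaussianVec θ v = τ / v * (1 + v) := by
    rw [integral_const_mul, integral_add (integrable_const 1) (hqi v), hq1]; simp
  have iC (x : Fin n → ℝ) : Integrable (fun y : Fin n → ℝ => (m : ℝ)⁻¹ *
      ∑ k ∈ Finset.univ.erase k₀, tilt vx τ (x (ι k)) * tilt vy τ (y (ι k))) (gaussianVec θ vy) :=
    (integrable_finsetSum _ fun k hk => (hti vy k hk).const_mul _).const_mul _
  have iAB : Integrable (fun y : Fin n → ℝ => τ * y (ι k₀) / vy - τ ^ 2 / (2 * vy) -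
      τ / vy * (1 + (y (ι k₀) - τ) ^ 2)) (gaussianVec θ vy) := iA.sub (iB vy)
  have iABc (x : Fin n → ℝ) : Integrable (fun y : Fin n → ℝ =>
      (-1 - τ / vx * (1 + (x (ι k₀) - τ) ^ 2)) + (τ * y (ι k₀) / vy - τ ^ 2 / (2 * vy) -
      τ / vy * (1 + (y (ι k₀) - τ) ^ 2))) (gaussianVec θ vy) := (integrable_const _).add iAB
  have hval (x : Fin n → ℝ) : ∫ y, blockScore vx vy τ ι k₀ x y ∂gaussianVec θ vy =
      (-1 - τ / vx * (1 + (x (ι k₀) - τ) ^ 2)) +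
        (τ ^ 2 / (2 * vy) - τ / vy * (1 + vy)) -
        (m : ℝ)⁻¹ * ∑ k ∈ Finset.univ.erase k₀, tilt vx τ (x (ι k)) := by
    simp only [blockScore]
    rw [integral_sub (iABc x) (iC x), integral_add (integrable_const _) iAB,
      integral_sub iA (iB vy), integral_sub ((hyi.const_mul τ).div_const _) (integrable_const _),
      vB, integral_div, integral_const_mul, hy1, integral_const_mul,
      integral_finsetSum _ fun k hk => (hti vy k hk).const_mul _]
    simp only [integral_const, probReal_univ, one_smul, integral_const_mul]
    congr 1
    · congr 1; field_simp; ring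
    · congr 1
      exact Finset.sum_congr rfl fun k hk => by rw [ht1 vy hvy k hk, mul_one]
  have jA : Integrable (fun x : Fin n → ℝ => -1 - τ / vx * (1 + (x (ι k₀) - τ) ^ 2))
      (gaussianVec θ vx) := (integrable_const _).sub (iB vx)
  have jB : Integrable (fun x : Fin n → ℝ => (-1 - τ / vx * (1 + (x (ι k₀) - τ) ^ 2)) +
        (τ ^ 2 / (2 * vy) - τ / vy * (1 + vy))) (gaussianVec θ vx) := jA.add (integrable_const _)
  have jC : Integrable (fun x : Fin n → ℝ => (m : ℝ)⁻¹ *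
      ∑ k ∈ Finset.univ.erase k₀, tilt vx τ (x (ι k))) (gaussianVec θ vx) :=
    (integrable_finsetSum _ fun k hk => hti vx k hk).const_mul _
  refine ⟨fun x => (iABc x).sub (iC x), ?_, ?_⟩
  · simp_rw [hval]; exact jB.sub jC
  · simp_rw [hval]
    rw [integral_sub jB jC, integral_add jA (integrable_const _),
      integral_sub (integrable_const _) (iB vx), vB, integral_const_mul,
      integral_finsetSum _ fun k hk => hti vx k hk,
      Finset.sum_congr rfl fun k hk => ht1 vx hvx k hk]
    simp only [integral_const, probReal_univ, one_smul, Finset.sum_const, nsmul_eq_mul, mul_one,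
      Finset.card_erase_of_mem (Finset.mem_univ k₀), Finset.card_univ, Fintype.card_fin]
    have h1 : (m : ℝ)⁻¹ * ((m - 1 : ℕ) : ℝ) ≤ 1 := by
      rw [inv_mul_le_iff₀ hm, mul_one]; exact_mod_cast Nat.sub_le m 1
    have h2 : τ / vx * (1 + vx) + τ / vy * (1 + vy) = τ * (1 / vx + 1 / vy + 2) := by
      field_simp; ring
    linarith

/-- The variational lower bound for the predictive risk at `θ`. -/
lemma ofReal_one_add_le_predictiveRisk_add {vx vy : ℝ≥0} {n : ℕ}
    {p : (Fin n → ℝ) → (Fin n → ℝ) → ℝ≥0∞} (hp : IsPredictiveDensity p) (θ : Fin n → ℝ)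
    {g : (Fin n → ℝ) → (Fin n → ℝ) → ℝ} (hg : Measurable (Function.uncurry g))
    (hgi : ∀ x, Integrable (g x) (gaussianVec θ vy))
    (hGi : Integrable (fun x => ∫ y, g x y ∂gaussianVec θ vy) (gaussianVec θ vx)) {c : ℝ}
    (hc : c ≤ ∫ x, ∫ y, g x y ∂gaussianVec θ vy ∂gaussianVec θ vx) :
    ENNReal.ofReal (1 + c) ≤ predictiveRisk vx vy p θ +
      ∫⁻ x, (∫⁻ y, p x y * ENNReal.ofReal (Real.exp (g x y))) ∂gaussianVec θ vx := by
  have hEm : Measurable fun x => ∫⁻ y, p x y * ENNReal.ofReal (Real.exp (g x y)) :=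
    Measurable.lintegral_prod_right' (f := fun a : (Fin n → ℝ) × (Fin n → ℝ) =>
      p a.1 a.2 * ENNReal.ofReal (Real.exp (g a.1 a.2)))
      (hp.1.mul (Real.measurable_exp.comp hg).ennreal_ofReal)
  calc ENNReal.ofReal (1 + c)
      ≤ ENNReal.ofReal (∫ x, (1 + ∫ y, g x y ∂gaussianVec θ vy) ∂gaussianVec θ vx) := by
        refine ENNReal.ofReal_le_ofReal ?_
        rw [integral_add (integrable_const _) hGi]
        simpa using hc
    _ ≤ ∫⁻ x, ENNReal.ofReal (1 + ∫ y, g x y ∂gaussianVec θ vy) ∂gaussianVec θ vx :=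
        ofReal_integral_le_lintegral ((integrable_const _).add hGi)
    _ ≤ ∫⁻ x, (InformationTheory.klDiv (gaussianVec θ vy) (volume.withDensity (p x)) +
          ∫⁻ y, p x y * ENNReal.ofReal (Real.exp (g x y))) ∂gaussianVec θ vx := by
        refine lintegral_mono fun x => ?_
        have hpx : Measurable (p x) := hp.1.comp measurable_prodMk_left
        have hgx : Measurable (g x) := hg.comp measurable_prodMk_left
        have := isProbabilityMeasure_withDensity_of_lintegral_eq_one (hp.2 x)
        have h := ofReal_one_add_integral_le_klDiv_add (μ := gaussianVec θ vy)
          (ν := volume.withDensity (p x)) hgx (hgi x)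
        have he : Measurable fun y => ENNReal.ofReal (Real.exp (g x y)) :=
          (Real.measurable_exp.comp hgx).ennreal_ofReal
        rwa [lintegral_withDensity_eq_lintegral_mul _ hpx he] at h
    _ = _ := lintegral_add_right _ hEm

lemma sum_lintegral_exp_le {vx : ℝ≥0} (hvx : vx ≠ 0) {n : ℕ} {S : Type*} [Fintype S]
    {p : (Fin n → ℝ) → (Fin n → ℝ) → ℝ≥0∞} (hp : IsPredictiveDensity p) (Θ : S → Fin n → ℝ)
    {G : S → (Fin n → ℝ) → (Fin n → ℝ) → ℝ≥0∞} (hG : ∀ σ, Measurable (Function.uncurry (G σ)))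
    {N : ℝ≥0∞}
    (h : ∀ x y, ∑ σ, gaussianVecPDF (Θ σ) vx x * G σ x y ≤ gaussianVecPDF 0 vx x * N) :
    ∑ σ, ∫⁻ x, (∫⁻ y, p x y * G σ x y) ∂gaussianVec (Θ σ) vx ≤ N := by
  have hpx (x) : Measurable (p x) := hp.1.comp measurable_prodMk_left
  have hj (σ) : Measurable fun a : (Fin n → ℝ) × (Fin n → ℝ) => p a.1 a.2 * G σ a.1 a.2 :=
    hp.1.mul (hG σ)
  have hjoint (σ) : Measurable fun a : (Fin n → ℝ) × (Fin n → ℝ) =>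
      gaussianVecPDF (Θ σ) vx a.1 * (p a.1 a.2 * G σ a.1 a.2) :=
    ((measurable_gaussianVecPDF (Θ σ) vx).comp measurable_fst).mul (hj σ)
  have hj' (σ) : Measurable fun x : Fin n → ℝ => ∫⁻ y, p x y * G σ x y :=
    (hj σ).lintegral_prod_right'
  have hjoint' (σ) : Measurable fun x : Fin n → ℝ =>
      ∫⁻ y, gaussianVecPDF (Θ σ) vx x * (p x y * G σ x y) :=
    (hjoint σ).lintegral_prod_right'
  calc ∑ σ, ∫⁻ x, (∫⁻ y, p x y * G σ x y) ∂gaussianVec (Θ σ) vx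
      = ∑ σ, ∫⁻ x, ∫⁻ y, gaussianVecPDF (Θ σ) vx x * (p x y * G σ x y) := by
        refine Finset.sum_congr rfl fun σ _ => ?_
        rw [gaussianVec_eq_withDensity _ hvx, lintegral_withDensity_eq_lintegral_mul _
          (measurable_gaussianVecPDF _ _) (hj' σ)]
        refine lintegral_congr fun x => ?_
        exact (lintegral_const_mul _ ((hj σ).comp measurable_prodMk_left)).symm
    _ = ∫⁻ x, ∫⁻ y, ∑ σ, gaussianVecPDF (Θ σ) vx x * (p x y * G σ x y) := by
        rw [← lintegral_finsetSum _ fun σ _ => hjoint' σ]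
        refine lintegral_congr fun x => ?_
        exact (lintegral_finsetSum _ fun σ _ => (hjoint σ).comp measurable_prodMk_left).symm
    _ ≤ ∫⁻ x, ∫⁻ y, gaussianVecPDF 0 vx x * N * p x y := by
        refine lintegral_mono fun x => lintegral_mono fun y => ?_
        calc ∑ σ, gaussianVecPDF (Θ σ) vx x * (p x y * G σ x y)
            = (∑ σ, gaussianVecPDF (Θ σ) vx x * G σ x y) * p x y := by
              rw [Finset.sum_mul]
              exact Finset.sum_congr rfl fun σ _ => by ring
          _ ≤ _ := mul_le_mul_left (h x y) _
    _ = ∫⁻ x, gaussianVecPDF 0 vx x * N := by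
        refine lintegral_congr fun x => ?_
        rw [lintegral_const_mul _ (hpx x), hp.2 x, mul_one]
    _ = N := by
        rw [lintegral_mul_const _ (measurable_gaussianVecPDF 0 vx), lintegral_gaussianVecPDF 0 hvx,
          one_mul]

/-- The sum over all spike positions factorises over the blocks, and the block averages of the
likelihood ratios in the denominators cancel each factor. -/
lemma sum_gaussianVecPDF_mul_exp_le {vx vy : ℝ≥0} (hvx : vx ≠ 0) (hvy : vy ≠ 0) {τ : ℝ}
    (hτ : 0 ≤ τ) {m n s : ℕ} (hm : 0 < m)
    (hτm : (1 / (vx : ℝ) + 1 / vy) * τ ^ 2 / 2 = Real.log m) (ι : Fin s → Fin m → Fin n)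
    (hι : ∀ σ : Fin s → Fin m, Function.Injective fun b => ι b (σ b)) (x y : Fin n → ℝ) :
    ∑ σ : Fin s → Fin m, gaussianVecPDF (spikes (fun b => ι b (σ b)) τ) vx x *
        ENNReal.ofReal (Real.exp (∑ b, blockScore vx vy τ (ι b) (σ b) x y)) ≤
      gaussianVecPDF 0 vx x * (m : ℝ≥0∞) ^ s := by
  obtain ⟨S, hSdef⟩ : ∃ S : Fin s → ℝ, ∀ b,
      S b = ∑ k, tilt vx τ (x (ι b k)) * tilt vy τ (y (ι b k)) := ⟨_, fun _ => rfl⟩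
  have hS (b : Fin s) : 0 < S b := by
    rw [hSdef]
    exact Finset.sum_pos (fun k _ => mul_pos (tilt_pos _ _ _) (tilt_pos _ _ _))
      ⟨⟨0, hm⟩, Finset.mem_univ _⟩
  obtain ⟨q, hq⟩ : ∃ q : Fin s → Fin m → ℝ, ∀ b k,
      q b k = m * (tilt vx τ (x (ι b k)) * tilt vy τ (y (ι b k))) / S b := ⟨_, fun _ _ => rfl⟩
  have hq0 (b k) : 0 ≤ q b k := by
    rw [hq]
    exact div_nonneg (mul_nonneg (Nat.cast_nonneg _)
      (mul_pos (tilt_pos _ _ _) (tilt_pos _ _ _)).le) (hS b).le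
  have hqsum (b) : ∑ k, q b k = m := by
    simp_rw [hq]
    rw [← Finset.sum_div, ← Finset.mul_sum, ← hSdef, mul_div_cancel_right₀ _ (hS b).ne']
  have hprod : ∑ σ : Fin s → Fin m, ∏ b, q b (σ b) = (m : ℝ) ^ s := by
    have h := Finset.prod_univ_sum (fun _ : Fin s => (Finset.univ : Finset (Fin m))) q
    rw [Fintype.piFinset_univ] at h
    rw [← h, Finset.prod_congr rfl fun b _ => hqsum b]
    simp
  calc _ ≤ ∑ σ : Fin s → Fin m, gaussianVecPDF 0 vx x * ENNReal.ofReal (∏ b, q b (σ b)) := by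
        refine Finset.sum_le_sum fun σ _ => ?_
        rw [gaussianVecPDF_spikes (hι σ) τ hvx, mul_assoc,
          ← ENNReal.ofReal_mul (Finset.prod_nonneg fun b _ => (tilt_pos _ _ _).le),
          Real.exp_sum, ← Finset.prod_mul_distrib]
        refine mul_le_mul_right (ENNReal.ofReal_le_ofReal ?_) _
        refine Finset.prod_le_prod
          (fun b _ => mul_nonneg (tilt_pos _ _ _).le (Real.exp_pos _).le) fun b _ => ?_
        rw [hq, hSdef]
        exact tilt_mul_exp_blockScore_le hvx hvy hτ hτm (ι b) (σ b) x y
    _ = gaussianVecPDF 0 vx x * ENNReal.ofReal (∑ σ : Fin s → Fin m, ∏ b, q b (σ b)) := by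
        rw [← Finset.mul_sum, ENNReal.ofReal_sum_of_nonneg]
        exact fun σ _ => Finset.prod_nonneg fun b _ => hq0 _ _
    _ = gaussianVecPDF 0 vx x * (m : ℝ≥0∞) ^ s := by
        rw [hprod, ENNReal.ofReal_pow (Nat.cast_nonneg m), ENNReal.ofReal_natCast]

/-- Placing one spike of height `τ` uniformly at random in each of `s` disjoint blocks of `m`
coordinates forces a maximal risk of `s` times the information `τ² / (2 vy)` of a spike in the
future, up to lower order terms, when `τ` is at the detection threshold of past and future
combined. -/
theorem ofReal_le_maxRisk {vx vy : ℝ≥0} (hvx : vx ≠ 0) (hvy : vy ≠ 0) {τ : ℝ} (hτ : 0 ≤ τ)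
    {m n s : ℕ} (hm : 0 < m) (hτm : (1 / (vx : ℝ) + 1 / vy) * τ ^ 2 / 2 = Real.log m)
    (hmn : s * m ≤ n) {p : (Fin n → ℝ) → (Fin n → ℝ) → ℝ≥0∞} (hp : IsPredictiveDensity p) :
    ENNReal.ofReal (s * (τ ^ 2 / (2 * vy) - 2 - τ * (1 / vx + 1 / vy + 2))) ≤
      maxRisk vx vy s p := by
  set c := (s : ℝ) * (τ ^ 2 / (2 * vy) - 2 - τ * (1 / vx + 1 / vy + 2)) with hc
  obtain ⟨ι, hι⟩ : ∃ ι : Fin s → Fin m → Fin n, ∀ b b' k k', ι b k = ι b' k' → b = b' ∧ k = k' :=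
    ⟨fun b k => Fin.castLE hmn (finProdFinEquiv (b, k)), fun b b' k k' h =>
      Prod.mk.inj (finProdFinEquiv.injective (Fin.castLE_injective hmn h))⟩
  have hgm (σ : Fin s → Fin m) : Measurable (Function.uncurry fun x y : Fin n → ℝ =>
      ∑ b, blockScore vx vy τ (ι b) (σ b) x y) :=
    Finset.measurable_sum _ fun b _ => measurable_blockScore vx vy τ (ι b) (σ b)
  have hblock (σ : Fin s → Fin m) (b : Fin s) :=
    integrable_integral_blockScore hvx hvy (ι := ι b) (k₀ := σ b)
      (θ := spikes (fun b => ι b (σ b)) τ) (spikes_apply (fun b => ι b (σ b)) τ b) fun k hk =>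
        spikes_of_forall_ne τ fun b' h => hk (by
          obtain ⟨rfl, h2⟩ := hι _ _ _ _ h
          exact h2.symm)
  have hsingle (σ : Fin s → Fin m) : ENNReal.ofReal (1 + c) ≤ maxRisk vx vy s p +
      ∫⁻ x, (∫⁻ y, p x y * ENNReal.ofReal (Real.exp (∑ b, blockScore vx vy τ (ι b) (σ b) x y)))
        ∂gaussianVec (spikes (fun b => ι b (σ b)) τ) vx := by
    have hval (x) : ∫ y, ∑ b, blockScore vx vy τ (ι b) (σ b) x y
          ∂gaussianVec (spikes (fun b => ι b (σ b)) τ) vy =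
        ∑ b, ∫ y, blockScore vx vy τ (ι b) (σ b) x y
          ∂gaussianVec (spikes (fun b => ι b (σ b)) τ) vy :=
      integral_finsetSum _ fun b _ => (hblock σ b).1 x
    refine (ofReal_one_add_le_predictiveRisk_add hp _ (hgm σ)
      (fun x => integrable_finsetSum _ fun b _ => (hblock σ b).1 x) ?_ ?_).trans
      (add_le_add_left (le_iSup₂_of_le (f := fun θ _ => predictiveRisk vx vy p θ) _
        (spikes_mem_sparseSet _ τ) le_rfl) _)
    · simp_rw [hval]
      exact integrable_finsetSum _ fun b _ => (hblock σ b).2.1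
    · simp_rw [hval]
      rw [integral_finsetSum _ fun b _ => (hblock σ b).2.1]
      calc c = ∑ _b : Fin s, (τ ^ 2 / (2 * vy) - 2 - τ * (1 / vx + 1 / vy + 2)) := by
            rw [Finset.sum_const, Finset.card_univ, Fintype.card_fin, nsmul_eq_mul, hc]
        _ ≤ _ := Finset.sum_le_sum fun b _ => (hblock σ b).2.2
  have hE := sum_lintegral_exp_le hvx hp (fun σ : Fin s → Fin m => spikes (fun b => ι b (σ b)) τ)
    (G := fun σ x y => ENNReal.ofReal (Real.exp (∑ b, blockScore vx vy τ (ι b) (σ b) x y)))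
    (fun σ => (Real.measurable_exp.comp (hgm σ)).ennreal_ofReal)
    (sum_gaussianVecPDF_mul_exp_le hvx hvy hτ hm hτm ι fun σ b b' h => (hι _ _ _ _ h).1)
  have havg : (m : ℝ≥0∞) ^ s * ENNReal.ofReal (1 + c) ≤
      (m : ℝ≥0∞) ^ s * (maxRisk vx vy s p + 1) := by
    calc (m : ℝ≥0∞) ^ s * ENNReal.ofReal (1 + c)
        = ∑ _σ : Fin s → Fin m, ENNReal.ofReal (1 + c) := by simp
      _ ≤ ∑ σ : Fin s → Fin m, (maxRisk vx vy s p +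
            ∫⁻ x, (∫⁻ y, p x y * ENNReal.ofReal (Real.exp (∑ b, blockScore vx vy τ (ι b) (σ b) x y)))
              ∂gaussianVec (spikes (fun b => ι b (σ b)) τ) vx) :=
          Finset.sum_le_sum fun σ _ => hsingle σ
      _ ≤ (m : ℝ≥0∞) ^ s * maxRisk vx vy s p + (m : ℝ≥0∞) ^ s := by
          rw [Finset.sum_add_distrib]
          gcongr
          simp
      _ = _ := by rw [mul_add, mul_one]
  have hfin : (m : ℝ≥0∞) ^ s ≠ ∞ := ENNReal.pow_ne_top (ENNReal.natCast_ne_top m)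
  have hne : (m : ℝ≥0∞) ^ s ≠ 0 := pow_ne_zero _ (by exact_mod_cast hm.ne')
  have h := (ENNReal.mul_le_mul_iff_right hne hfin).1 havg
  rcases le_or_gt c 0 with h0 | h0
  · rw [ENNReal.ofReal_of_nonpos h0]; exact zero_le
  · rw [ENNReal.ofReal_add zero_le_one h0.le, ENNReal.ofReal_one, add_comm] at h
    exact (ENNReal.add_le_add_iff_right ENNReal.one_ne_top).1 h

/-! ### Asymptotics -/

lemma neg_log_one_sub_le {ε δ : ℝ} (h0 : 0 < ε) (hδ : 0 < δ) (h : ε ≤ δ / (1 + δ)) :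
    -Real.log (1 - ε) ≤ ε * (1 + δ) := by
  rw [le_div_iff₀ (by linarith)] at h
  have h1 : 0 < 1 - ε := by nlinarith
  have h2 := Real.log_le_sub_one_of_pos (inv_pos.2 h1)
  rw [Real.log_inv] at h2
  have h3 : (1 - ε)⁻¹ ≤ 1 + ε * (1 + δ) := by
    rw [inv_le_iff_one_le_mul₀ h1]
    nlinarith
  linarith

lemma HasRiskBound.mono {η : ℝ} {vx vy : ℝ≥0} {t b b' : ℝ} (h : HasRiskBound η vx vy t b)
    (hb : b ≤ b') : HasRiskBound η vx vy t b' := by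
  obtain ⟨g, h, h1, h2, h3, h4, h5⟩ := h
  exact ⟨g, h, h1, h2, h3, h4, h5.trans hb⟩

lemma tendsto_log_inv_atTop : Tendsto (fun η : ℝ => Real.log η⁻¹) (𝓝[>] 0) atTop :=
  Real.tendsto_log_atTop.comp tendsto_inv_nhdsGT_zero

lemma eventually_pos_le {a : ℝ} (ha : 0 < a) : ∀ᶠ η : ℝ in 𝓝[>] 0, 0 < η ∧ η ≤ a := by
  filter_upwards [self_mem_nhdsWithin, nhdsWithin_le_nhds (Iic_mem_nhds ha)] with η h1 h2
  exact ⟨h1, h2⟩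

lemma eventually_one_le_period {r : ℝ} (hr : 0 < r) : ∀ᶠ η : ℝ in 𝓝[>] 0, 1 ≤ period η r := by
  filter_upwards [eventually_pos_le (show (0 : ℝ) < 1 / 2 by norm_num),
    tendsto_log_inv_atTop.eventually_ge_atTop ((1 + r) / r)] with η h h3
  have h1 : η < 1 := by linarith [h.2]
  refine le_trans ?_ (lambdaF_le_period hr h.1 h1)
  have h4 : 1 ≤ lambdaF η r ^ 2 := by
    rw [lambdaF_sq hr h.1 h1]
    have : r / (1 + r) * ((1 + r) / r) ≤ r / (1 + r) * Real.log η⁻¹ :=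
      mul_le_mul_of_nonneg_left h3 (by positivity)
    rw [div_mul_div_cancel₀ (by positivity), div_self hr.ne'] at this
    linarith
  nlinarith [lambdaF_nonneg η r]

lemma eventually_forall_hasRiskBound {vx vy : ℝ≥0} (hvx : vx ≠ 0) (hvy : vy ≠ 0) {δ : ℝ}
    (hδ : 0 < δ) : ∀ᶠ η : ℝ in 𝓝[>] 0, ∀ t : ℝ,
      HasRiskBound η vx vy t (Real.log η⁻¹ / (1 + (vy : ℝ) / vx) * (1 + δ)) := by
  have hvx' : (0 : ℝ) < vx := by positivity
  have hvy' : (0 : ℝ) < vy := by positivity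
  have hr : 0 < (vy : ℝ) / vx := by positivity
  obtain ⟨C, hC⟩ := exists_hasRiskBound hvx hvy
    (ε := min (1 / 16) (δ / (32 * (1 + (vy : ℝ) / vx)))) (by positivity) (min_le_left _ _)
  set r := (vy : ℝ) / vx
  filter_upwards [eventually_pos_le (show (0 : ℝ) < 1 / 2 by norm_num),
    eventually_one_le_period hr,
    tendsto_log_inv_atTop.eventually_ge_atTop (2 * (1 + r) / δ * C)] with η h hP hL t
  refine (hC η h.1 h.2 hP t).mono ?_
  have hL0 := log_inv_pos h.1 (by linarith [h.2] : η < 1)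
  have h1 : 16 * min (1 / 16) (δ / (32 * (1 + r))) * Real.log η⁻¹ ≤
      δ / 2 * (Real.log η⁻¹ / (1 + r)) := by
    calc 16 * min (1 / 16) (δ / (32 * (1 + r))) * Real.log η⁻¹
        ≤ 16 * (δ / (32 * (1 + r))) * Real.log η⁻¹ := by
          gcongr; exact min_le_right _ _
      _ = δ / 2 * (Real.log η⁻¹ / (1 + r)) := by field_simp; ring
  have h2 : C ≤ δ / 2 * (Real.log η⁻¹ / (1 + r)) := by
    calc C = δ / 2 * ((2 * (1 + r) / δ * C) / (1 + r)) := by field_simp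
      _ ≤ _ := by gcongr
  linarith

/-- The maximal risk over the sparse set, split into the zero and the nonzero coordinates. -/
lemma maxRisk_clusterEstimate_le {η : ℝ} (h0 : 0 < η) (h1 : η ≤ 1 / 2) {vx vy : ℝ≥0}
    (hvx : vx ≠ 0) (hvy : vy ≠ 0) {n s : ℕ} {B : ℝ} (hB : 0 ≤ B)
    (h : ∀ t, HasRiskBound η vx vy t B) :
    maxRisk vx vy s (clusterEstimate n η vx vy) ≤ ENNReal.ofReal (n * (2 * η) + s * B) := by
  classical
  refine iSup₂_le fun θ hθ => ?_
  have hz : HasRiskBound η vx vy 0 (2 * η) :=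
    (hasRiskBound_zero h0 (by linarith) hvx).mono
      ((neg_log_one_sub_le h0 one_pos (by linarith)).trans (by linarith))
  refine (predictiveRisk_clusterEstimate_le h0 (by linarith) hvx hvy θ
    (fun i => if θ i = 0 then 2 * η else B) fun i => ?_).trans (ENNReal.ofReal_le_ofReal ?_)
  · by_cases hi : θ i = 0
    · simpa [hi] using hz
    · simpa [hi] using h (θ i)
  · calc ∑ i, (if θ i = 0 then 2 * η else B)
        ≤ ∑ i, (2 * η + if θ i ≠ 0 then B else 0) := by
          refine Finset.sum_le_sum fun i _ => ?_
          by_cases hi : θ i = 0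
          · simp [hi]
          · simp only [hi, if_false, ne_eq, not_false_iff, if_true]; linarith
      _ = n * (2 * η) + (Finset.univ.filter fun i => θ i ≠ 0).card * B := by
          rw [Finset.sum_add_distrib, ← Finset.sum_filter]; simp
      _ ≤ _ := by
          have : ((Finset.univ.filter fun i => θ i ≠ 0).card : ℝ) ≤ s := by exact_mod_cast hθ
          nlinarith

/-- The lower bound of the minimax risk in terms of `η = s / n`, with blocks of size `⌊n / s⌋`. -/
lemma eventually_le_minimaxRisk {vx vy : ℝ≥0} (hvx : vx ≠ 0) (hvy : vy ≠ 0) {δ : ℝ}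
    (hδ : 0 < δ) : ∀ᶠ η : ℝ in 𝓝[>] 0, ∀ n s : ℕ, 1 ≤ s → η = (s : ℝ) / n →
      ENNReal.ofReal (s * (Real.log η⁻¹ / (1 + (vy : ℝ) / vx) * (1 - δ))) ≤
        minimaxRisk vx vy n s := by
  have hvx' : (0 : ℝ) < vx := by positivity
  have hvy' : (0 : ℝ) < vy := by positivity
  have hr : 0 < (vy : ℝ) / vx := by positivity
  obtain ⟨a, ha⟩ : ∃ a : ℝ, a = 1 / vx + 1 / vy := ⟨_, rfl⟩
  have ha0 : 0 < a := by rw [ha]; positivity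
  set r := (vy : ℝ) / vx with hrdef
  have har : a * vy = 1 + r := by rw [ha, hrdef]; field_simp; ring
  -- Lower order terms, as coefficients of `1` and of the square root of the logarithm.
  set A := Real.log 2 / (1 + r) + 2
  set B := √(2 / a) * (a + 2)
  have hA : 0 ≤ A := by have := Real.log_nonneg one_le_two; positivity
  have hB : 0 ≤ B := by positivity
  have hsqrt : Tendsto (fun η : ℝ => √(Real.log η⁻¹)) (𝓝[>] 0) atTop :=
    Real.tendsto_sqrt_atTop.comp tendsto_log_inv_atTop
  filter_upwards [eventually_pos_le (show (0 : ℝ) < 1 / 2 by norm_num),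
    hsqrt.eventually_ge_atTop 1, hsqrt.eventually_ge_atTop ((A + B) / (δ / (1 + r)))]
    with η h hs1 hs2 n s hs hη
  have hs0 : (0 : ℝ) < s := by exact_mod_cast hs
  have hn0 : (0 : ℝ) < n := by
    rcases Nat.eq_zero_or_pos n with rfl | hn
    · rw [hη] at h; simp at h
    · exact_mod_cast hn
  have hL0 := log_inv_pos h.1 (by linarith [h.2] : η < 1)
  set L := Real.log η⁻¹ with hL
  have hηi : η⁻¹ = n / s := by rw [hη, inv_div]
  have h2 : 2 ≤ η⁻¹ := by
    rw [le_inv_comm₀ (by norm_num) h.1]; linarith [h.2]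
  obtain ⟨m, hm⟩ : ∃ m : ℕ, m = n / s := ⟨_, rfl⟩
  have hmle : (m : ℝ) ≤ η⁻¹ := by rw [hηi, hm]; exact Nat.cast_div_le
  have hmge : η⁻¹ / 2 ≤ m := by
    have h3 : η⁻¹ ≤ m + 1 := by
      rw [hηi, div_le_iff₀ hs0, hm]
      exact_mod_cast (Nat.lt_mul_of_div_lt (Nat.lt_succ_self (n / s)) hs).le
    linarith
  have hm1 : (1 : ℝ) ≤ m := by linarith
  have hm0 : 0 < m := by exact_mod_cast (by linarith : (0 : ℝ) < m)
  have hlogm0 : 0 ≤ Real.log m := Real.log_nonneg hm1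
  have hlogm1 : Real.log m ≤ L := Real.log_le_log (by linarith) hmle
  have hlogm2 : L - Real.log 2 ≤ Real.log m := by
    rw [hL, ← Real.log_div (by linarith) (by norm_num)]
    exact Real.log_le_log (by linarith) hmge
  set τ := √(2 * Real.log m / a) with hτ
  have hτsq : τ ^ 2 = 2 * Real.log m / a := Real.sq_sqrt (by positivity)
  have hτm : (1 / (vx : ℝ) + 1 / vy) * τ ^ 2 / 2 = Real.log m := by
    rw [← ha, hτsq]; field_simp
  have hτle : τ ≤ √(2 / a) * √L := by
    rw [← Real.sqrt_mul (by positivity)]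
    refine Real.sqrt_le_sqrt ?_
    rw [div_mul_eq_mul_div]
    gcongr
  have hmn : s * m ≤ n := by rw [hm]; exact Nat.mul_div_le n s
  refine le_iInf₂ fun p hp => le_trans (ENNReal.ofReal_le_ofReal ?_)
    (ofReal_le_maxRisk hvx hvy (Real.sqrt_nonneg _) hm0 hτm hmn hp)
  refine mul_le_mul_of_nonneg_left ?_ hs0.le
  have e1 : τ ^ 2 / (2 * vy) = Real.log m / (1 + r) := by
    rw [hτsq, ← har]; field_simp
  have e2 : (L - Real.log 2) / (1 + r) ≤ Real.log m / (1 + r) := by gcongr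
  have e3 : τ * (1 / vx + 1 / vy + 2) ≤ B * √L := by
    rw [← ha]
    calc τ * (a + 2) ≤ (√(2 / a) * √L) * (a + 2) := by gcongr
      _ = B * √L := by ring
  have e4 : A + B * √L ≤ δ / (1 + r) * L := by
    have h5 : A + B ≤ √L * (δ / (1 + r)) := by rwa [div_le_iff₀ (by positivity)] at hs2
    calc A + B * √L ≤ (A + B) * √L := by nlinarith
      _ ≤ (√L * (δ / (1 + r))) * √L := by gcongr
      _ = δ / (1 + r) * (√L * √L) := by ring
      _ = _ := by rw [Real.mul_self_sqrt hL0.le]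
  have e5 : L / (1 + r) * (1 - δ) = L / (1 + r) - δ / (1 + r) * L := by ring
  rw [sub_div] at e2
  rw [e1, e5]
  linarith

end SparsePrediction

theorem theorem1 (vx vy : ℝ≥0) (hvx : 0 < vx) (hvy : 0 < vy) (r : ℝ) (hr : r = (vy : ℝ) / vx)
    (s : ℕ → ℕ) (hs : ∀ᶠ n in atTop, 1 ≤ s n)
    (η : ℕ → ℝ) (hη : ∀ n, η n = (s n : ℝ) / n) (hη0 : Tendsto η atTop (𝓝 0)) :
    -- the maximal risk is at most `n η_n log(η_n⁻¹) / (1 + r) * (1 + o(1))`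
    (∀ δ : ℝ, 0 < δ → ∀ᶠ n : ℕ in atTop,
      SparsePrediction.maxRisk vx vy (s n) (SparsePrediction.clusterEstimate n (η n) vx vy) ≤
        ENNReal.ofReal (n * η n * Real.log (η n)⁻¹ / (1 + r) * (1 + δ))) ∧
    -- it is (eventually) a genuine predictive density estimate, and asymptotically minimax
    (∀ᶠ n : ℕ in atTop,
      SparsePrediction.IsPredictiveDensity (SparsePrediction.clusterEstimate n (η n) vx vy)) ∧
    Tendsto (fun n : ℕ =>
      SparsePrediction.maxRisk vx vy (s n) (SparsePrediction.clusterEstimate n (η n) vx vy) /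
        SparsePrediction.minimaxRisk vx vy n (s n)) atTop (𝓝 1) ∧
    -- the univariate risk at the origin is at most `ε (1 + o(1))` as `ε → 0+`
    (∀ δ : ℝ, 0 < δ → ∀ᶠ ε : ℝ in 𝓝[>] 0,
      SparsePrediction.predictiveRisk vx vy (SparsePrediction.clusterEstimate 1 ε vx vy)
        (fun _ => 0) ≤ ENNReal.ofReal (ε * (1 + δ))) ∧
    -- the univariate risk off the origin is at most `λ_f² / (2r) * (1 + o(1))`
    (∀ δ : ℝ, 0 < δ → ∀ᶠ ε : ℝ in 𝓝[>] 0,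
      (⨆ (t : ℝ) (_ : t ≠ 0),
        SparsePrediction.predictiveRisk vx vy (SparsePrediction.clusterEstimate 1 ε vx vy)
          (fun _ => t)) ≤
        ENNReal.ofReal (SparsePrediction.lambdaF ε r ^ 2 / (2 * r) * (1 + δ))) := by
  subst hr
  have hx : vx ≠ 0 := hvx.ne'
  have hy : vy ≠ 0 := hvy.ne'
  have hvx' : (0 : ℝ) < vx := by positivity
  have hvy' : (0 : ℝ) < vy := by positivity
  have hr0 : 0 < (vy : ℝ) / vx := by positivity
  set r := (vy : ℝ) / vx
  have hpos : ∀ᶠ n : ℕ in atTop, 0 < η n := by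
    filter_upwards [hs, eventually_gt_atTop 0] with n h1 h2
    rw [hη]
    have : (0 : ℝ) < s n := by exact_mod_cast h1
    have : (0 : ℝ) < n := by exact_mod_cast h2
    positivity
  have hη1 : Tendsto η atTop (𝓝[>] 0) :=
    tendsto_nhdsWithin_iff.2 ⟨hη0, hpos⟩
  have hsn : ∀ᶠ n : ℕ in atTop, (n : ℝ) * η n = s n := by
    filter_upwards [eventually_gt_atTop 0] with n h2
    have : (0 : ℝ) < n := by exact_mod_cast h2
    rw [hη]; field_simp
  have hhalf : (0 : ℝ) < 1 / 2 := by norm_num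
  have upper : ∀ δ : ℝ, 0 < δ → ∀ᶠ n : ℕ in atTop,
      SparsePrediction.maxRisk vx vy (s n) (SparsePrediction.clusterEstimate n (η n) vx vy) ≤
        ENNReal.ofReal (s n * (Real.log (η n)⁻¹ / (1 + r) * (1 + δ))) := by
    intro δ hδ
    filter_upwards [hη1.eventually (SparsePrediction.eventually_pos_le hhalf),
      hη1.eventually (SparsePrediction.eventually_forall_hasRiskBound hx hy (half_pos hδ)),
      hη1.eventually (SparsePrediction.tendsto_log_inv_atTop.eventually_ge_atTop
        (4 * (1 + r) / δ)), hsn] with n h1 h2 h3 h4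
    have hL := SparsePrediction.log_inv_pos h1.1 (by linarith [h1.2] : η n < 1)
    refine (SparsePrediction.maxRisk_clusterEstimate_le h1.1 h1.2 hx hy (by positivity) h2).trans
      (ENNReal.ofReal_le_ofReal ?_)
    have h5 : 2 ≤ δ / 2 * (Real.log (η n)⁻¹ / (1 + r)) := by
      calc (2 : ℝ) = δ / 2 * ((4 * (1 + r) / δ) / (1 + r)) := by field_simp; norm_num
        _ ≤ _ := by gcongr
    have e : (n : ℝ) * (2 * η n) = s n * 2 := by rw [← h4]; ring
    rw [e, ← mul_add]
    refine mul_le_mul_of_nonneg_left ?_ (Nat.cast_nonneg _)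
    linarith
  have hpred : ∀ᶠ n : ℕ in atTop,
      SparsePrediction.IsPredictiveDensity (SparsePrediction.clusterEstimate n (η n) vx vy) := by
    filter_upwards [hη1.eventually (SparsePrediction.eventually_pos_le hhalf)] with n h1
    exact SparsePrediction.isPredictiveDensity_clusterEstimate h1.1 (by linarith [h1.2]) hx hy n
  refine ⟨fun δ hδ => ?_, hpred, ?_, fun δ hδ => ?_, fun δ hδ => ?_⟩
  · filter_upwards [upper δ hδ, hsn] with n h1 h2
    refine h1.trans (le_of_eq ?_)
    rw [h2]; congr 1; ring
  · -- The two bounds hold with the same leading term, which cancels in the ratio.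
    have sandwich : ∀ δ : ℝ, 0 < δ → δ < 1 → ∀ᶠ n : ℕ in atTop,
        1 ≤ SparsePrediction.maxRisk vx vy (s n) (SparsePrediction.clusterEstimate n (η n) vx vy) /
          SparsePrediction.minimaxRisk vx vy n (s n) ∧
        SparsePrediction.maxRisk vx vy (s n) (SparsePrediction.clusterEstimate n (η n) vx vy) /
          SparsePrediction.minimaxRisk vx vy n (s n) ≤ ENNReal.ofReal ((1 + δ) / (1 - δ)) := by
      intro δ hδ hδ1
      filter_upwards [upper δ hδ, hη1.eventually (SparsePrediction.eventually_le_minimaxRisk hx hy hδ),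
        hη1.eventually (SparsePrediction.eventually_pos_le hhalf), hs, hpred] with n hu hl h1 hs1 hp
      have hlow := hl n (s n) hs1 (hη n)
      have hle : SparsePrediction.minimaxRisk vx vy n (s n) ≤ SparsePrediction.maxRisk vx vy (s n)
          (SparsePrediction.clusterEstimate n (η n) vx vy) := iInf₂_le _ hp
      have hL := SparsePrediction.log_inv_pos h1.1 (by linarith [h1.2] : η n < 1)
      have hs0 : (0 : ℝ) < s n := by exact_mod_cast hs1
      have hδ' : 0 < 1 - δ := by linarith
      have hlpos : 0 < (s n : ℝ) * (Real.log (η n)⁻¹ / (1 + r) * (1 - δ)) := by positivity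
      have hne : SparsePrediction.minimaxRisk vx vy n (s n) ≠ 0 :=
        ((ENNReal.ofReal_pos.2 hlpos).trans_le hlow).ne'
      have htop : SparsePrediction.minimaxRisk vx vy n (s n) ≠ ∞ :=
        ((hle.trans hu).trans_lt ENNReal.ofReal_lt_top).ne
      refine ⟨?_, ?_⟩
      · rw [ENNReal.le_div_iff_mul_le (Or.inl hne) (Or.inl htop), one_mul]; exact hle
      · calc _ ≤ ENNReal.ofReal (s n * (Real.log (η n)⁻¹ / (1 + r) * (1 + δ))) /
              ENNReal.ofReal (s n * (Real.log (η n)⁻¹ / (1 + r) * (1 - δ))) :=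
              ENNReal.div_le_div hu hlow
          _ = _ := by
              rw [← ENNReal.ofReal_div_of_pos hlpos]
              congr 1
              generalize Real.log (η n)⁻¹ = L at hL
              field_simp
    refine tendsto_order.2 ⟨fun a ha => ?_, fun a ha => ?_⟩
    · filter_upwards [sandwich (1 / 2) (by norm_num) (by norm_num)] with n hn
      exact ha.trans_le hn.1
    · have hc : Tendsto (fun δ : ℝ => ENNReal.ofReal ((1 + δ) / (1 - δ))) (𝓝[>] 0) (𝓝 1) := by
        have h1 : ContinuousAt (fun δ : ℝ => (1 + δ) / (1 - δ)) 0 :=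
          ContinuousAt.div (by fun_prop) (by fun_prop) (by norm_num)
        have h2 := (ENNReal.continuous_ofReal.continuousAt.comp h1).tendsto
        simp only [Function.comp_def, add_zero, sub_zero, div_one, ENNReal.ofReal_one] at h2
        exact h2.mono_left nhdsWithin_le_nhds
      obtain ⟨δ, hδa, hδ⟩ := ((hc.eventually_lt_const ha).and
        (SparsePrediction.eventually_pos_le hhalf)).exists
      filter_upwards [sandwich δ hδ.1 (by linarith [hδ.2])] with n hn
      exact hn.2.trans_lt hδa
  · have hd : 0 < min (1 / 2) (δ / (1 + δ)) := by positivity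
    filter_upwards [SparsePrediction.eventually_pos_le hd] with ε h
    have h1 : ε < 1 := by linarith [h.2.trans (min_le_left _ _)]
    refine (SparsePrediction.predictiveRisk_clusterEstimate_le h.1 h1 hx hy (fun _ => 0)
      (fun _ => -Real.log (1 - ε)) fun _ =>
        SparsePrediction.hasRiskBound_zero h.1 h1 hx).trans (ENNReal.ofReal_le_ofReal ?_)
    simpa using SparsePrediction.neg_log_one_sub_le h.1 hδ (h.2.trans (min_le_right _ _))
  · filter_upwards [SparsePrediction.eventually_pos_le hhalf,
      SparsePrediction.eventually_forall_hasRiskBound hx hy hδ] with ε h hb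
    have h1 : ε < 1 := by linarith [h.2]
    refine iSup₂_le fun t _ => ?_
    refine (SparsePrediction.predictiveRisk_clusterEstimate_le h.1 h1 hx hy (fun _ => t)
      _ fun _ => hb t).trans (le_of_eq ?_)
    rw [SparsePrediction.lambdaF_sq hr0 h.1 h1, Fin.sum_univ_one]
    congr 1
    change Real.log ε⁻¹ / (1 + r) * (1 + δ) = _
    field_simp
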